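/- Fix an integer $r\ge 1$. For each $n$ let $y_1,\dots,y_n$ be independent real random variables (their laws may depend on $n$ and are arbitrary), and put $F_i^*(t)=\mathbb P(y_i\le t)$, $F^*(t)=(F_1^*(t),\dots,F_n^*(t))$ and $w(t)=(1_{\{y_1\le t\}},\dots,1_{\{y_n\le t\}})$. For $\theta\in\mathbb R^n$ let $\mathrm{TV}^{(r)}(\theta)=n^{r-1}\|D^{(r)}\theta\|_1$, where $D^{(1)}\theta=(\theta_2-\theta_1,\dots,\theta_n-\theta_{n-1})$ and $D^{(r)}=D^{(1)}\circ D^{(r-1)}$. Let $V=V_n:=\sup_{t\in\mathbb R}\mathrm{TV}^{(r)}(F^*(t))$ and let $\eta=\eta_n$ satisfy $\eta\asymp\max\{n^{1/(4r+2)}V^{1/(2r+1)},\sqrt{\log n}\}$ as $n\to\infty$. For every $t\in\mathbb R$ let $$\widehat F(t)=\underset{\theta\in\mathbb R^n}{\arg\min}\Big\{\tfrac12\|w(t)-\theta\|^2+\lambda_t\,\mathrm{TV}^{(r)}(\theta)\Big\},\qquad \lambda_t=\frac{\eta^2}{4\,\mathrm{TV}^{(r)}(F^*(t))},$$ where $\lambda_t=\infty$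 if $\mathrm{TV}^{(r)}(F^*(t))=0$, in which case $\widehat F(t)$ minimizes $\|w(t)-\theta\|^2$ over all $\theta$ with $\mathrm{TV}^{(r)}(\theta)=0$. Then, as $n\to\infty$, $$\sup_{t\in\mathbb R}\ \sum_{i=1}^n\frac1n\big(\widehat F_i(t)-F_i^*(t)\big)^2=O_{\mathbb P}\!\left(\frac{V^{2/(2r+1)}}{n^{2r/(2r+1)}}+\frac{\log n}{n}\right),$$ that is, for every $\varepsilon>0$ there is an $M>0$ such that, for all sufficiently large $n$, the left side exceeds $M$ times the expression in parentheses with probability at most $\varepsilon$. -/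

import Mathlib

open MeasureTheory ProbabilityTheory Filter Asymptotics
open scoped ENNReal

noncomputable section

namespace TrendFiltering

/-- The first difference `D⁽¹⁾ θ = (θ₂ - θ₁, …, θₘ - θₘ₋₁) ∈ ℝ^{m-1}` of a vector `θ ∈ ℝᵐ`. -/
def firstDiff {m : ℕ} (θ : Fin m → ℝ) : Fin (m - 1) → ℝ := fun i =>
  θ ⟨(i : ℕ) + 1, by omega⟩ - θ ⟨(i : ℕ), by omega⟩

/-- The `r`-th difference `D⁽ʳ⁾ θ ∈ ℝ^{n-r}`: `D⁽⁰⁾ θ = θ`, `D⁽ʳ⁺¹⁾ θ = D⁽¹⁾ (D⁽ʳ⁾ θ)`. -/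
def iterDiff {n : ℕ} (θ : Fin n → ℝ) : (r : ℕ) → (Fin (n - r) → ℝ)
  | 0 => θ
  | r + 1 => firstDiff (iterDiff θ r)

/-- The `r`-th order total variation `TV⁽ʳ⁾(θ) = n^{r-1} ‖D⁽ʳ⁾ θ‖₁` (used for `r ≥ 1`). -/
def TV (r : ℕ) {n : ℕ} (θ : Fin n → ℝ) : ℝ :=
  (n : ℝ) ^ (r - 1) * ∑ i, |iterDiff θ r i|

section Model

variable {Ω : Type*} {n : ℕ}

/-- `w(t) = (1{y₁ ≤ t}, …, 1{yₙ ≤ t})`, for a realization `y` of the sample. -/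
def indicatorVec (y : Fin n → ℝ) (t : ℝ) : Fin n → ℝ := fun i =>
  Set.indicator (Set.Iic t) (fun _ => (1 : ℝ)) (y i)

/-- `F*(t) = (P(y₁ ≤ t), …, P(yₙ ≤ t))`. -/
def trueCDF [MeasurableSpace Ω] (μ : Measure Ω) (y : Fin n → Ω → ℝ) (t : ℝ) : Fin n → ℝ :=
  fun i => μ.real {ω | y i ω ≤ t}

/-- `V = sup_t TV⁽ʳ⁾(F*(t))`. The supremum is finite, all entries of `F*(t)` lying in `[0,1]`. -/
def maxTV [MeasurableSpace Ω] (r : ℕ) (μ : Measure Ω) (y : Fin n → Ω → ℝ) : ℝ :=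
  ⨆ t : ℝ, TV r (trueCDF μ y t)

/-- The tuning parameter `λ_t = η² / (4 pen(F*(t)))` with `pen = TV⁽ʳ⁾`, as an element of `[0,∞]`:
for `η ≠ 0` it is `∞` where `pen(F*(t)) = 0`. -/
def tuning [MeasurableSpace Ω] (r : ℕ) (μ : Measure Ω) (y : Fin n → Ω → ℝ) (η t : ℝ) : ℝ≥0∞ :=
  ENNReal.ofReal (η ^ 2) / (4 * ENNReal.ofReal (TV r (trueCDF μ y t)))

/-- The penalized objective `½ ‖w - θ‖² + lam · TV⁽ʳ⁾(θ)`. For `lam = ∞` (with `∞ · 0 = 0`) this is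
`½ ‖w - θ‖²` on the set `TV⁽ʳ⁾(θ) = 0` and `∞` off it. -/
def objective (r : ℕ) (lam : ℝ≥0∞) (w θ : Fin n → ℝ) : ℝ≥0∞ :=
  ENNReal.ofReal ((1 / 2) * ∑ i, (w i - θ i) ^ 2) + lam * ENNReal.ofReal (TV r θ)

/-- `Fhat(t)` minimizes the penalized objective over `ℝⁿ`, for every realization of the sample
and every `t`, with the tuning parameters `λ_t = η² / (4 TV⁽ʳ⁾(F*(t)))`. -/
def IsPenalizedEstimator [MeasurableSpace Ω] (r : ℕ) (μ : Measure Ω) (y : Fin n → Ω → ℝ) (η : ℝ)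
    (Fhat : Ω → ℝ → Fin n → ℝ) : Prop :=
  ∀ ω t θ, objective r (tuning r μ y η t) (indicatorVec (fun i => y i ω) t) (Fhat ω t) ≤
    objective r (tuning r μ y η t) (indicatorVec (fun i => y i ω) t) θ

/-- The worst-case mean squared error `sup_t (1/n) ∑ᵢ (F̂ᵢ(t) - Fᵢ*(t))²`, as an element of
`[0,∞]`. -/
def worstCaseMSE [MeasurableSpace Ω] (μ : Measure Ω) (y : Fin n → Ω → ℝ)
    (Fhat : Ω → ℝ → Fin n → ℝ) (ω : Ω) : ℝ≥0∞ :=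
  ⨆ t : ℝ, ENNReal.ofReal (∑ i, (1 / (n : ℝ)) * (Fhat ω t i - trueCDF μ y t i) ^ 2)

end Model

/-- The order of magnitude of `η`: `max {n^{1/(4r+2)} V^{1/(2r+1)}, √(log n)}`. -/
def etaScale (r n : ℕ) (V : ℝ) : ℝ :=
  max ((n : ℝ) ^ (1 / (4 * (r : ℝ) + 2)) * V ^ (1 / (2 * (r : ℝ) + 1))) (Real.sqrt (Real.log n))

/-- The rate `V^{2/(2r+1)} / n^{2r/(2r+1)} + log n / n`. -/
def rate (r n : ℕ) (V : ℝ) : ℝ :=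
  V ^ (2 / (2 * (r : ℝ) + 1)) / (n : ℝ) ^ (2 * (r : ℝ) / (2 * (r : ℝ) + 1)) + Real.log n / n

/-- `X n = O_P(a n)`, for `[0,∞]`-valued `X n` on probability spaces that may vary with `n`
(`μ n` of a set that is not measurable is its outer measure). -/
def IsBigOInProbability {Ω : ℕ → Type*} [∀ n, MeasurableSpace (Ω n)] (μ : ∀ n, Measure (Ω n))
    (X : ∀ n, Ω n → ℝ≥0∞) (a : ℕ → ℝ) : Prop :=
  ∀ ε : ℝ, 0 < ε → ∃ M : ℝ, 0 < M ∧
    ∀ᶠ n in atTop, μ n {ω | ENNReal.ofReal (M * a n) < X n ω} ≤ ENNReal.ofReal ε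

end TrendFiltering

end

/-! ### Local approximation by discrete polynomials. -/

namespace TrendFiltering

open Finset fwdDiff

/-! Let `δ` be the estimation error at `t` and `ε` the centred indicator vector. Comparing the
minimizer with the truth gives `‖δ‖²/2 ≤ ⟨ε, δ⟩ + λ_t (TV(F*) - TV(F̂))`. If `⟨ε, δ⟩ ≤ Q ‖δ‖ + K
TV(δ)` with `K ≤ λ_t`, the penalty absorbs the rough part and `‖δ‖² ≤ 4 Q² + 2 η²`
(`sum_sq_error_le`). What is needed is such a bound, uniform in `t`, with `Q²` of order `η²`.

For a block length `2 ^ κ`, `exists_multiscale_functionals` splits `δ` into a piecewise polynomial,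
from a space of dimension `O(n / 2 ^ κ)`, and a remainder whose first-order variation is controlled
by the highest difference of `δ`. The remainder is expanded in a Haar system with thresholds linear
in the level. The `ℓ¹` norms of its coefficients decay geometrically towards fine levels, so the
part of the noise below the thresholds costs only `K TV(δ)`. The number of coefficients grows
geometrically but the sub-Gaussian tails at the thresholds decay faster, so the energy above the
thresholds is of order `n / 2 ^ κ`, with no logarithm (`measure_excess_ge_le`).

For uniformity, `t` is sorted by the integer part of `∑ i, F_i*(t)`, which gives at most `n + 1`
cells. Within a cell the noise moves by no more than the number of observations in a set of expected
count at most one, so a union bound costs only `log n` (`measure_noise_bad_le`).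

Finally `n / 2 ^ κ` is taken of order `η²`. The lower bound on `η` then yields `K ≤ λ_t`
(`resolution_cond`), and the upper bound yields the rate. If no such block length fits, `η²` is at
least of order `n` and a trivial bound suffices. -/

lemma sum_range_fwdDiff (h : ℕ → ℝ) (i : ℕ) : ∑ k ∈ range i, Δ_[1] h k = h i - h 0 :=
  Finset.sum_range_sub h i

lemma abs_sub_le_sum_abs_fwdDiff (h : ℕ → ℝ) {i L : ℕ} (hi : i < L) :
    |h i - h 0| ≤ ∑ k ∈ range (L - 1), |Δ_[1] h k| := by
  rw [← sum_range_fwdDiff]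
  exact (abs_sum_le_sum_abs _ _).trans
    (sum_le_sum_of_subset_of_nonneg (range_mono (by omega)) fun _ _ _ => abs_nonneg _)

lemma fwdDiff_fun_sub (f g : ℕ → ℝ) : Δ_[1] (fun i => f i - g i) = fun i => Δ_[1] f i - Δ_[1] g i := by
  funext i; simp only [fwdDiff]; ring

lemma fwdDiff_iter_fun_sub (f g : ℕ → ℝ) (r i : ℕ) :
    (Δ_[1])^[r] (fun i => f i - g i) i = (Δ_[1])^[r] f i - (Δ_[1])^[r] g i := by
  induction r generalizing f g with
  | zero => rfl
  | succ r ih => simp only [Function.iterate_succ_apply, fwdDiff_fun_sub, ih]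

/-- Discrete Taylor approximation on `[0, L)` by a function with vanishing `(r + 1)`-st difference. -/
lemma exists_fwdDiff_eq_zero_near (r : ℕ) (g : ℕ → ℝ) (L : ℕ) :
    ∃ P : ℕ → ℝ, (∀ i, (Δ_[1])^[r + 1] P i = 0) ∧
      (∀ i < L, |g i - P i| ≤ (L : ℝ) ^ r * ∑ i ∈ range (L - (r + 1)), |(Δ_[1])^[r + 1] g i|) ∧
      ∑ i ∈ range (L - 1), |Δ_[1] (fun i => g i - P i) i| ≤
        (L : ℝ) ^ r * ∑ i ∈ range (L - (r + 1)), |(Δ_[1])^[r + 1] g i| := by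
  induction r generalizing g L with
  | zero =>
    refine ⟨fun _ => g 0, fun i => by simp [fwdDiff], fun i hi => ?_, ?_⟩
    · simpa using abs_sub_le_sum_abs_fwdDiff g hi
    · simp [fwdDiff]
  | succ r ih =>
    obtain ⟨P₁, h0, h1, -⟩ := ih (Δ_[1] g) (L - 1)
    rw [show L - 1 - (r + 1) = L - (r + 1 + 1) by omega] at h1
    -- The approximant is the discrete antiderivative of the one for `Δ g`, matched at `0`; summing
    -- the errors costs one factor `L`.
    have hΔ : Δ_[1] (fun i => g 0 + ∑ k ∈ range i, P₁ k) = P₁ := by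
      funext i; simp [fwdDiff, sum_range_succ]
    set v := ∑ i ∈ range (L - (r + 1 + 1)), |(Δ_[1])^[r + 1 + 1] g i| with hv
    have hv0 : 0 ≤ v := sum_nonneg fun _ _ => abs_nonneg _
    have hsum : ∑ i ∈ range (L - 1), |Δ_[1] (fun i => g i - (g 0 + ∑ k ∈ range i, P₁ k)) i| ≤
        (L : ℝ) ^ (r + 1) * v := by
      rw [fwdDiff_fun_sub, hΔ]
      calc _ ≤ ∑ i ∈ range (L - 1), ((L - 1 : ℕ) : ℝ) ^ r * v :=
            sum_le_sum fun i hi => h1 i (mem_range.1 hi)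
        _ = ((L - 1 : ℕ) : ℝ) ^ (r + 1) * v := by simp; ring
        _ ≤ _ := by gcongr; omega
    refine ⟨fun i => g 0 + ∑ k ∈ range i, P₁ k, fun i => ?_, fun i hi => ?_, hsum⟩
    · rw [Function.iterate_succ_apply, hΔ, h0]
    · have := abs_sub_le_sum_abs_fwdDiff (fun i => g i - (g 0 + ∑ k ∈ range i, P₁ k)) hi
      simp only [range_zero, sum_empty, add_zero, sub_self, sub_zero] at this
      exact this.trans hsum

lemma eq_of_fwdDiff_eq_zero {f : ℕ → ℝ} (h : ∀ i, Δ_[1] f i = 0) (i : ℕ) : f i = f 0 := by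
  have := sum_range_fwdDiff f i
  simp only [h, sum_const_zero] at this
  linarith

/-- A discrete polynomial of degree `d` controls its leading coefficient through its mean. -/
lemma exists_leading_coeff_bound (d : ℕ) : ∃ C : ℝ, 0 ≤ C ∧ ∀ L : ℕ, 2 ^ d ≤ L → ∀ P : ℕ → ℝ,
    (∀ i, (Δ_[1])^[d + 1] P i = 0) →
      |(Δ_[1])^[d] P 0| * (L : ℝ) ^ (d + 1) ≤ C * ∑ i ∈ range L, |P i| := by
  induction d with
  | zero =>
    refine ⟨1, zero_le_one, fun L _ P hP => ?_⟩
    have : ∀ i, P i = P 0 := eq_of_fwdDiff_eq_zero hP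
    simp only [this, Function.iterate_zero, id, sum_const, card_range, nsmul_eq_mul]
    simp [mul_comm]
  | succ d ih =>
    obtain ⟨C, hC, h⟩ := ih
    refine ⟨3 ^ (d + 1 + 1) * C, by positivity, fun L hL P hP => ?_⟩
    have hd1 : 1 ≤ 2 ^ d := Nat.one_le_two_pow
    rw [pow_succ] at hL
    -- The half-length difference `P (i + m) - P i` has degree one less, its leading coefficient
    -- gains a factor `m`, and its `ℓ¹` norm on `[0, m)` is at most that of `P` on `[0, 2m)`.
    set m := L / 2 with hm
    have hm1 : 2 ^ d ≤ m := by omega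
    have hconst : ∀ i, (Δ_[1])^[d + 1] P i = (Δ_[1])^[d + 1] P 0 :=
      eq_of_fwdDiff_eq_zero fun i => by
      rw [← Function.iterate_succ_apply' (fwdDiff 1)]; exact hP i
    have hlin : (Δ_[1])^[d] P m - (Δ_[1])^[d] P 0 = m * (Δ_[1])^[d + 1] P 0 := by
      rw [← sum_range_fwdDiff, sum_congr rfl fun i _ => by
        rw [← Function.iterate_succ_apply' (fwdDiff 1) d P, hconst i]]
      simp
    have h1 := h m hm1 (fun i => P (i + m) - P i) fun i => by
      rw [fwdDiff_iter_fun_sub, fwdDiff_iter_comp_add, hconst, hconst i, sub_self]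
    rw [fwdDiff_iter_fun_sub, fwdDiff_iter_comp_add, zero_add, hlin, abs_mul, Nat.abs_cast] at h1
    have h2 : ∑ i ∈ range m, |P (i + m) - P i| ≤ ∑ i ∈ range L, |P i| := by
      calc _ ≤ ∑ i ∈ range m, (|P i| + |P (m + i)|) := sum_le_sum fun i _ => by
            rw [add_comm m i, add_comm |P i|]; exact abs_sub _ _
        _ = ∑ i ∈ range (m + m), |P i| := by rw [sum_add_distrib, sum_range_add]
        _ ≤ _ := sum_le_sum_of_subset_of_nonneg (range_mono (by omega)) fun _ _ _ => abs_nonneg _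
    have hL3 : (L : ℝ) ≤ 3 * m := by exact_mod_cast (by omega : L ≤ 3 * m)
    calc |(Δ_[1])^[d + 1] P 0| * (L : ℝ) ^ (d + 1 + 1)
        ≤ |(Δ_[1])^[d + 1] P 0| * (3 * m) ^ (d + 1 + 1) := by gcongr
      _ = 3 ^ (d + 1 + 1) * (m * |(Δ_[1])^[d + 1] P 0| * (m : ℝ) ^ (d + 1)) := by ring
      _ ≤ 3 ^ (d + 1 + 1) * (C * ∑ i ∈ range m, |P (i + m) - P i|) := by gcongr
      _ ≤ 3 ^ (d + 1 + 1) * (C * ∑ i ∈ range L, |P i|) := by gcongr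
      _ = _ := by ring

lemma fwdDiff_iter_cast_choose (r : ℕ) (c : ℝ) :
    (Δ_[1])^[r] (fun i : ℕ => c * (i.choose r : ℝ)) = fun _ => c := by
  induction r with
  | zero => simp
  | succ r ih =>
    rw [Function.iterate_succ_apply, ← ih]
    congr 1
    funext i
    simp [fwdDiff, Nat.choose_succ_succ']
    ring

/-- Discrete Markov inequality: the total variation of a discrete polynomial on `[0, L)` is
controlled by its mean. -/
lemma exists_markov_bound (r : ℕ) : ∃ C : ℝ, 0 ≤ C ∧ ∀ L : ℕ, 2 ^ r ≤ L → ∀ P : ℕ → ℝ,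
    (∀ i, (Δ_[1])^[r] P i = 0) →
      L * ∑ i ∈ range (L - 1), |Δ_[1] P i| ≤ C * ∑ i ∈ range L, |P i| := by
  induction r with
  | zero => exact ⟨0, le_rfl, fun L _ P hP => by simp_all [fwdDiff]⟩
  | succ r ih =>
    obtain ⟨C, hC, h⟩ := ih
    obtain ⟨D, hD, h'⟩ := exists_leading_coeff_bound r
    refine ⟨C * (1 + D) + D, by positivity, fun L hL P hP => ?_⟩
    have hLr : 2 ^ r ≤ L := le_trans (Nat.pow_le_pow_right (by norm_num) (by omega)) hL
    set c := (Δ_[1])^[r] P 0 with hc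
    have hconst : ∀ i, (Δ_[1])^[r] P i = c :=
      eq_of_fwdDiff_eq_zero fun i => by
      rw [← Function.iterate_succ_apply' (fwdDiff 1)]; exact hP i
    have hlead : |c| * (L : ℝ) ^ (r + 1) ≤ D * ∑ i ∈ range L, |P i| := h' L hLr P hP
    -- Removing the leading Newton term lowers the degree; by `hlead` that term has sup norm and
    -- variation of the order of the mean of `|P|`.
    set R : ℕ → ℝ := fun i => c * (i.choose r : ℝ) with hR
    have h1 := h L hLr (fun i => P i - R i) fun i => by
      rw [fwdDiff_iter_fun_sub, fwdDiff_iter_cast_choose, hconst, sub_self]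
    have hRle : ∀ i < L, |R i| ≤ |c| * (L : ℝ) ^ r := fun i hi => by
      rw [hR, abs_mul, Nat.abs_cast]
      have : i.choose r ≤ L ^ r := (Nat.choose_le_pow i r).trans (Nat.pow_le_pow_left hi.le r)
      gcongr
      exact_mod_cast this
    have hRvar : ∑ i ∈ range (L - 1), |Δ_[1] R i| ≤ |c| * (L : ℝ) ^ r := by
      have h2 : ∀ i, |Δ_[1] R i| = |c| * (((i + 1).choose r : ℝ) - i.choose r) := fun i => by
        have : (i.choose r : ℝ) ≤ (i + 1).choose r := by
          exact_mod_cast Nat.choose_le_choose r (Nat.le_succ i)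
        simp only [hR, fwdDiff]
        rw [← mul_sub, abs_mul, abs_of_nonneg (sub_nonneg.2 this)]
      simp only [h2]
      rw [← mul_sum, sum_range_sub (fun i => (i.choose r : ℝ))]
      have : (L - 1).choose r ≤ L ^ r :=
        (Nat.choose_le_pow _ r).trans (Nat.pow_le_pow_left (Nat.sub_le _ _) r)
      have h3 : ((L - 1).choose r : ℝ) ≤ (L : ℝ) ^ r := by exact_mod_cast this
      have h4 : (0 : ℝ) ≤ ((0 : ℕ).choose r : ℝ) := by positivity
      gcongr
      linarith
    have h5 : ∑ i ∈ range L, |P i - R i| ≤ ∑ i ∈ range L, |P i| + |c| * (L : ℝ) ^ (r + 1) := by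
      calc _ ≤ ∑ i ∈ range L, (|P i| + |c| * (L : ℝ) ^ r) := sum_le_sum fun i hi =>
            (abs_sub _ _).trans (by gcongr; exact hRle i (mem_range.1 hi))
        _ = _ := by rw [sum_add_distrib]; simp; ring
    have h6 : ∑ i ∈ range (L - 1), |Δ_[1] P i| ≤
        ∑ i ∈ range (L - 1), |Δ_[1] (fun i => P i - R i) i| + |c| * (L : ℝ) ^ r := by
      refine le_trans ?_ (add_le_add_right hRvar _)
      rw [← sum_add_distrib, fwdDiff_fun_sub]
      refine sum_le_sum fun i _ => ?_
      have := abs_add_le (Δ_[1] P i - Δ_[1] R i) (Δ_[1] R i)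
      simpa using this
    calc (L : ℝ) * ∑ i ∈ range (L - 1), |Δ_[1] P i|
        ≤ L * (∑ i ∈ range (L - 1), |Δ_[1] (fun i => P i - R i) i| + |c| * (L : ℝ) ^ r) := by gcongr
      _ = L * ∑ i ∈ range (L - 1), |Δ_[1] (fun i => P i - R i) i| + |c| * (L : ℝ) ^ (r + 1) := by ring
      _ ≤ C * (∑ i ∈ range L, |P i| + |c| * (L : ℝ) ^ (r + 1)) + |c| * (L : ℝ) ^ (r + 1) := by
          exact add_le_add_left (h1.trans (by gcongr)) _
      _ ≤ C * (∑ i ∈ range L, |P i| + D * ∑ i ∈ range L, |P i|) + D * ∑ i ∈ range L, |P i| := by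
          gcongr
      _ = _ := by ring

lemma mul_abs_le_sum_add (P : ℕ → ℝ) {i L : ℕ} (hi : i < L) :
    L * |P i| ≤ ∑ j ∈ range L, |P j| + 2 * (L * ∑ k ∈ range (L - 1), |Δ_[1] P k|) := by
  have : ∑ _j ∈ range L, |P i| ≤
      ∑ j ∈ range L, (|P j| + 2 * ∑ k ∈ range (L - 1), |Δ_[1] P k|) := by
    refine sum_le_sum fun j hj => ?_
    have h1 := abs_sub_le_sum_abs_fwdDiff P hi
    have h2 := abs_sub_le_sum_abs_fwdDiff P (mem_range.1 hj)
    have h3 : |P i| ≤ |P j| + |P i - P 0| + |P j - P 0| := by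
      calc |P i| = |P j + (P i - P 0) - (P j - P 0)| := by ring_nf
        _ ≤ _ := (abs_sub _ _).trans (by gcongr; exact abs_add_le _ _)
    linarith
  rw [sum_add_distrib] at this
  simp only [sum_const, card_range, nsmul_eq_mul] at this
  linarith

/-- Stable local polynomial approximation. -/
lemma exists_stable_approx (r : ℕ) : ∃ C : ℝ, 0 ≤ C ∧ ∀ L : ℕ, 2 ^ (r + 1) ≤ L → ∀ g : ℕ → ℝ,
    ∃ P : ℕ → ℝ, (∀ i, (Δ_[1])^[r + 1] P i = 0) ∧
      ∑ i ∈ range L, P i ^ 2 ≤ C * ∑ i ∈ range L, g i ^ 2 ∧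
      (∀ i < L, |g i - P i| ≤
        C * ((L : ℝ) ^ r * ∑ i ∈ range (L - (r + 1)), |(Δ_[1])^[r + 1] g i|)) ∧
      ∑ i ∈ range (L - 1), |Δ_[1] (fun i => g i - P i) i| ≤
        C * ((L : ℝ) ^ r * ∑ i ∈ range (L - (r + 1)), |(Δ_[1])^[r + 1] g i|) := by
  obtain ⟨C, hC, hM⟩ := exists_markov_bound (r + 1)
  refine ⟨4 + 4 * C, by positivity, fun L hL g => ?_⟩
  obtain ⟨p, hp0, hp1, hp2⟩ := exists_fwdDiff_eq_zero_near r g L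
  set e := (L : ℝ) ^ r * ∑ i ∈ range (L - (r + 1)), |(Δ_[1])^[r + 1] g i| with he
  have he0 : 0 ≤ e := by positivity
  have hL0 : (0 : ℝ) < L := by
    have : 0 < 2 ^ (r + 1) := by positivity
    exact_mod_cast this.trans_le hL
  have hG0 : 0 ≤ ∑ i ∈ range L, g i ^ 2 := by positivity
  have hp3 : ∑ i ∈ range L, p i ^ 2 ≤ 2 * ∑ i ∈ range L, g i ^ 2 + 2 * (L * e ^ 2) := by
    calc _ ≤ ∑ i ∈ range L, (2 * g i ^ 2 + 2 * e ^ 2) := sum_le_sum fun i hi => by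
          have h := sq_le_sq' (abs_le.1 (hp1 i (mem_range.1 hi))).1 (abs_le.1 (hp1 i (mem_range.1 hi))).2
          nlinarith [sq_nonneg (g i + (g i - p i))]
      _ = _ := by rw [sum_add_distrib, ← mul_sum]; simp; ring
  have hCe : e ≤ (4 + 4 * C) * e := by nlinarith
  -- The Taylor approximant `p` may have energy of order `L e²`. If `g` has at least energy `L e²`,
  -- `p` is kept. Otherwise `p` has mean size at most `2 e`, the Markov bound makes its sup norm and
  -- variation `O(e)`, and the zero polynomial already approximates `g` well enough.
  by_cases hcase : L * e ^ 2 ≤ ∑ i ∈ range L, g i ^ 2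
  · refine ⟨p, hp0, ?_, fun i hi => (hp1 i hi).trans hCe, hp2.trans hCe⟩
    nlinarith
  · push Not at hcase
    have h0 : (Δ_[1])^[r + 1] (fun _ : ℕ => (0 : ℝ)) = fun _ => 0 := by
      funext i
      have := fwdDiff_iter_fun_sub (fun _ => 0) (fun _ => 0) (r + 1) i
      simpa only [sub_self] using this
    have hp4 : ∑ i ∈ range L, |p i| ≤ 2 * (L * e) := by
      refine le_of_sq_le_sq ?_ (by positivity)
      have h := sq_sum_le_card_mul_sum_sq (s := range L) (f := fun i => |p i|)
      simp only [sq_abs, card_range] at h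
      calc _ ≤ _ := h
        _ ≤ L * (4 * (L * e ^ 2)) := by gcongr; linarith
        _ = _ := by ring
    have hM' := hM L hL p hp0
    have hp5 : L * ∑ i ∈ range (L - 1), |Δ_[1] p i| ≤ L * (2 * C * e) := by
      calc _ ≤ _ := hM'
        _ ≤ C * (2 * (L * e)) := by gcongr
        _ = _ := by ring
    have hvar := le_of_mul_le_mul_left hp5 hL0
    refine ⟨fun _ => 0, fun i => by rw [h0], by simp; positivity, fun i hi => ?_, ?_⟩
    · have h6 := mul_abs_le_sum_add p hi
      have h7 : L * |p i| ≤ L * (2 * e + 4 * C * e) := by nlinarith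
      have h8 := le_of_mul_le_mul_left h7 hL0
      have h9 := abs_add_le (g i - p i) (p i)
      have h10 := hp1 i hi
      simp only [sub_add_cancel] at h9
      rw [sub_zero]
      nlinarith
    · have : ∑ i ∈ range (L - 1), |Δ_[1] g i| ≤
          ∑ i ∈ range (L - 1), |Δ_[1] (fun i => g i - p i) i| + ∑ i ∈ range (L - 1), |Δ_[1] p i| := by
        rw [← sum_add_distrib, fwdDiff_fun_sub]
        refine sum_le_sum fun i _ => ?_
        have := abs_add_le (Δ_[1] g i - Δ_[1] p i) (Δ_[1] p i)
        simpa using this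
      simp only [sub_zero]
      nlinarith

end TrendFiltering

/-! ### Piecewise polynomial approximation on blocks. -/

namespace TrendFiltering

open Finset fwdDiff

lemma sum_range_eq_sum_blocks {e : ℕ → ℕ} (he0 : e 0 = 0) (he : Monotone e) (h : ℕ → ℝ) (M : ℕ) :
    ∑ i ∈ range (e M), h i = ∑ j ∈ range M, ∑ i ∈ range (e (j + 1) - e j), h (e j + i) := by
  induction M with
  | zero => simp [he0]
  | succ M ih =>
    rw [sum_range_succ, ← ih, ← sum_range_add, Nat.add_sub_cancel' (he (Nat.le_succ M))]

/-- Newton's forward difference formula, truncated at the degree; it places the block polynomials in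
the span of the `blockMonomial`s. -/
lemma eq_sum_choose_of_fwdDiff_eq_zero {r : ℕ} {P : ℕ → ℝ} (hP : ∀ i, (Δ_[1])^[r] P i = 0) (i : ℕ) :
    P i = ∑ k ∈ range r, (Δ_[1])^[k] P 0 * (i.choose k : ℝ) := by
  have hP' : ∀ k, r ≤ k → ∀ i, (Δ_[1])^[k] P i = 0 := fun k hk => by
    induction k, hk using Nat.le_induction with
    | base => exact hP
    | succ k _ ih => intro i; rw [Function.iterate_succ_apply' (fwdDiff 1)]; simp [fwdDiff, ih]
  have h := shift_eq_sum_fwdDiff_iter 1 P i 0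
  simp only [smul_eq_mul, mul_one, zero_add, nsmul_eq_mul] at h
  rw [h]
  have h1 : ∑ k ∈ range (i + 1), (i.choose k : ℝ) * (Δ_[1])^[k] P 0 =
      ∑ k ∈ range (max (i + 1) r), (i.choose k : ℝ) * (Δ_[1])^[k] P 0 :=
    sum_subset (range_mono (le_max_left _ _)) fun k _ hk => by
      rw [Nat.choose_eq_zero_of_lt (by simpa using hk)]; simp
  have h2 : ∑ k ∈ range r, (i.choose k : ℝ) * (Δ_[1])^[k] P 0 =
      ∑ k ∈ range (max (i + 1) r), (i.choose k : ℝ) * (Δ_[1])^[k] P 0 :=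
    sum_subset (range_mono (le_max_right _ _)) fun k _ hk => by
      rw [hP' k (by simpa using hk)]; simp
  rw [h1, ← h2]
  exact sum_congr rfl fun k _ => mul_comm _ _

/-- The generator `1_{[s, t)}(i) * choose (i - s) k` of the space of piecewise polynomials. -/
def blockMonomial (s t k : ℕ) : ℕ → ℝ := fun i => if s ≤ i ∧ i < t then ((i - s).choose k : ℝ) else 0

/-- The breakpoints of the partition of `[0, n)` into `n / b` blocks of length in `[b, 2b)`. -/
def breakpoint (n b : ℕ) (j : ℕ) : ℕ := if j < n / b then j * b else n

section breakpoint

variable {n b : ℕ}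

lemma breakpoint_zero (hb : 0 < b) (hn : b ≤ n) : breakpoint n b 0 = 0 := by
  have : 0 < n / b := Nat.div_pos hn hb
  simp [breakpoint, this]

lemma breakpoint_last : breakpoint n b (n / b) = n := by simp [breakpoint]

lemma breakpoint_mono : Monotone (breakpoint n b) := by
  refine monotone_nat_of_le_succ fun j => ?_
  unfold breakpoint
  split_ifs with h1 h2
  · exact Nat.mul_le_mul_right b (Nat.le_succ j)
  · exact (Nat.mul_le_mul_right b h1.le).trans (Nat.div_mul_le_self n b)
  · omega
  · exact le_rfl

lemma breakpoint_sub (hb : 0 < b) {j : ℕ} (hj : j < n / b) :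
    b ≤ breakpoint n b (j + 1) - breakpoint n b j ∧
      breakpoint n b (j + 1) - breakpoint n b j ≤ 2 * b := by
  have h1 := Nat.div_add_mod n b
  have h2 := Nat.mod_lt n hb
  unfold breakpoint
  rw [if_pos hj]
  split_ifs with h
  · rw [add_mul]; omega
  · have : n / b = j + 1 := by omega
    rw [this, mul_add, mul_comm] at h1
    omega

end breakpoint

/-- Splitting a sequence supported on `[0, n)` into a piecewise polynomial and a remainder of small
total variation. -/
lemma exists_piecewise_approx (r : ℕ) : ∃ C : ℝ, 0 ≤ C ∧ ∀ n b : ℕ, 2 ^ (r + 1) ≤ b → b ≤ n →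
    ∀ g : ℕ → ℝ, (∀ i, n ≤ i → g i = 0) → ∃ q : ℕ → ℝ,
      q ∈ Submodule.span ℝ (Set.range fun p : Fin (n / b) × Fin (r + 1) =>
        blockMonomial (breakpoint n b p.1) (breakpoint n b (p.1 + 1)) p.2) ∧
      (∀ i, n ≤ i → q i = 0) ∧
      ∑ i ∈ range n, q i ^ 2 ≤ C * ∑ i ∈ range n, g i ^ 2 ∧
      ∀ N, ∑ i ∈ range N, |Δ_[1] (fun i => g i - q i) i| ≤
        C * ((b : ℝ) ^ r * ∑ i ∈ range (n - (r + 1)), |(Δ_[1])^[r + 1] g i|) := by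
  obtain ⟨C, hC, hA⟩ := exists_stable_approx r
  refine ⟨C + 3 * (C * 2 ^ r), by positivity, fun n b hb hbn g hg => ?_⟩
  have hb0 : 0 < b := lt_of_lt_of_le (by positivity) hb
  set e := breakpoint n b with he
  have he0 : e 0 = 0 := breakpoint_zero hb0 hbn
  have heM : e (n / b) = n := breakpoint_last
  have hem : Monotone e := breakpoint_mono
  have hlen : ∀ j < n / b, b ≤ e (j + 1) - e j ∧ e (j + 1) - e j ≤ 2 * b :=
    fun j hj => breakpoint_sub hb0 hj
  have hA' : ∀ j, ∃ P : ℕ → ℝ, j < n / b → (∀ i, (Δ_[1])^[r + 1] P i = 0) ∧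
      ∑ i ∈ range (e (j + 1) - e j), P i ^ 2 ≤ C * ∑ i ∈ range (e (j + 1) - e j), g (e j + i) ^ 2 ∧
      (∀ i < e (j + 1) - e j, |g (e j + i) - P i| ≤
        C * (((2 * b : ℕ) : ℝ) ^ r *
          ∑ i ∈ range (e (j + 1) - e j - (r + 1)), |(Δ_[1])^[r + 1] g (e j + i)|)) ∧
      ∑ i ∈ range (e (j + 1) - e j - 1), |Δ_[1] (fun i => g (e j + i) - P i) i| ≤
        C * (((2 * b : ℕ) : ℝ) ^ r *
          ∑ i ∈ range (e (j + 1) - e j - (r + 1)), |(Δ_[1])^[r + 1] g (e j + i)|) := by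
    intro j
    by_cases hj : j < n / b
    · obtain ⟨P, h0, h1, h2, h3⟩ :=
        hA (e (j + 1) - e j) (hb.trans (hlen j hj).1) (fun i => g (i + e j))
      have hsum : ∑ i ∈ range (e (j + 1) - e j - (r + 1)),
          |(Δ_[1])^[r + 1] (fun i => g (i + e j)) i| =
          ∑ i ∈ range (e (j + 1) - e j - (r + 1)), |(Δ_[1])^[r + 1] g (e j + i)| :=
        sum_congr rfl fun i _ => by rw [fwdDiff_iter_comp_add, add_comm i]
      have hle : C * (((e (j + 1) - e j : ℕ) : ℝ) ^ r *
          ∑ i ∈ range (e (j + 1) - e j - (r + 1)), |(Δ_[1])^[r + 1] g (e j + i)|) ≤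
          C * (((2 * b : ℕ) : ℝ) ^ r *
          ∑ i ∈ range (e (j + 1) - e j - (r + 1)), |(Δ_[1])^[r + 1] g (e j + i)|) := by
        have := (hlen j hj).2
        gcongr
      rw [hsum] at h2 h3
      simp only [add_comm _ (e j)] at h1 h2 h3
      exact ⟨P, fun _ => ⟨h0, h1, fun i hi => (h2 i hi).trans hle, h3.trans hle⟩⟩
    · exact ⟨0, fun h => absurd h hj⟩
  choose P hP using hA'
  -- Only differences whose stencil lies inside the block are counted, so the `v j` add up to at
  -- most the global sum. The value `0` past the last block lets the passage to zero at `n` be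
  -- treated like an interior jump.
  set v : ℕ → ℝ := fun j => if j < n / b then
    ∑ i ∈ range (e (j + 1) - e j - (r + 1)), |(Δ_[1])^[r + 1] g (e j + i)| else 0 with hv
  have hv0 : ∀ j, 0 ≤ v j := fun j => by simp only [hv]; split_ifs <;> positivity
  set B : ℝ := C * ((2 * b : ℕ) : ℝ) ^ r with hB
  have hB0 : 0 ≤ B := by positivity
  set q : ℕ → ℝ := fun i => ∑ j ∈ range (n / b),
    if e j ≤ i ∧ i < e (j + 1) then P j (i - e j) else 0 with hq
  have hq_block : ∀ j < n / b, ∀ i < e (j + 1) - e j, q (e j + i) = P j i := by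
    intro j hj i hi
    simp only [hq]
    rw [sum_eq_single_of_mem j (mem_range.2 hj), if_pos (by omega), Nat.add_sub_cancel_left]
    intro k _ hkj
    rw [if_neg]
    rintro ⟨h1, h2⟩
    rcases lt_or_gt_of_ne hkj with h | h
    · have := hem (Nat.succ_le_of_lt h); simp only [Nat.succ_eq_add_one] at this; omega
    · have := hem (Nat.succ_le_of_lt h); simp only [Nat.succ_eq_add_one] at this; omega
  have hq_out : ∀ i, n ≤ i → q i = 0 := fun i hi => by
    simp only [hq]
    refine sum_eq_zero fun j hj => if_neg ?_
    have := hem (Nat.succ_le_of_lt (mem_range.1 hj))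
    simp only [Nat.succ_eq_add_one] at this
    omega
  refine ⟨q, ?_, hq_out, ?_, fun N => ?_⟩
  · have : q = ∑ j ∈ range (n / b), ∑ k ∈ range (r + 1),
        ((Δ_[1])^[k] (P j) 0) • blockMonomial (e j) (e (j + 1)) k := by
      funext i
      simp only [hq, Finset.sum_apply, Pi.smul_apply, smul_eq_mul, blockMonomial]
      refine sum_congr rfl fun j hj => ?_
      split_ifs with h
      · exact eq_sum_choose_of_fwdDiff_eq_zero (hP j (mem_range.1 hj)).1 _
      · simp
    rw [this]
    refine Submodule.sum_mem _ fun j hj => Submodule.sum_mem _ fun k hk => Submodule.smul_mem _ _ ?_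
    exact Submodule.subset_span ⟨(⟨j, mem_range.1 hj⟩, ⟨k, mem_range.1 hk⟩), rfl⟩
  · have h1 := sum_range_eq_sum_blocks he0 hem (fun i => q i ^ 2) (n / b)
    have h2 := sum_range_eq_sum_blocks he0 hem (fun i => g i ^ 2) (n / b)
    rw [heM] at h1 h2
    rw [h1, h2, mul_sum]
    refine sum_le_sum fun j hj => ?_
    have hj := mem_range.1 hj
    rw [sum_congr rfl fun i hi => by rw [hq_block j hj i (mem_range.1 hi)]]
    refine (hP j hj).2.1.trans ?_
    gcongr
    nlinarith [show (0 : ℝ) ≤ 2 ^ r by positivity]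
  · set f : ℕ → ℝ := fun i => g i - q i with hf
    have hf_out : ∀ i, n ≤ i → f i = 0 := fun i hi => by simp [hf, hg i hi, hq_out i hi]
    have hf_block : ∀ j < n / b, ∀ i < e (j + 1) - e j, |f (e j + i)| ≤ B * v j := by
      intro j hj i hi
      simp only [hf, hq_block j hj i hi, hv, if_pos hj]
      rw [hB, mul_assoc]
      exact (hP j hj).2.2.1 i hi
    have hf_start : ∀ j, j ≤ n / b → |f (e j)| ≤ B * v j := by
      intro j hj
      rcases hj.lt_or_eq with h | h
      · have := hf_block j h 0 (by have := (hlen j h).1; omega)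
        simpa using this
      · rw [h, heM, hf_out n le_rfl, abs_zero]; exact mul_nonneg hB0 (hv0 _)
    have hN : ∑ i ∈ range N, |Δ_[1] f i| ≤ ∑ i ∈ range n, |Δ_[1] f i| := by
      rcases le_total N n with h | h
      · exact sum_le_sum_of_subset_of_nonneg (range_mono h) fun _ _ _ => abs_nonneg _
      · refine (sum_subset (range_mono h) fun i _ hi => ?_).symm.le
        simp only [mem_range, not_lt] at hi
        simp [fwdDiff, hf_out i hi, hf_out (i + 1) (by omega)]
    -- A block contributes its inner variation and one jump at its right end, bounded by the sup
    -- norms of the remainder on both sides; hence the factor `3` in the constant.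
    have hblock : ∀ j < n / b, ∑ i ∈ range (e (j + 1) - e j), |Δ_[1] f (e j + i)| ≤
        B * v j + (B * v j + B * v (j + 1)) := by
      intro j hj
      have hl := hlen j hj
      obtain ⟨m, hm⟩ : ∃ m, e (j + 1) - e j = m + 1 := ⟨e (j + 1) - e j - 1, by omega⟩
      rw [hm, sum_range_succ]
      refine add_le_add ?_ ?_
      · have h3 := (hP j hj).2.2.2
        rw [hm, Nat.add_sub_cancel, ← hm, ← mul_assoc] at h3
        refine le_trans (le_of_eq (sum_congr rfl fun i hi => ?_)) (h3.trans (le_of_eq ?_))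
        · have hi := mem_range.1 hi
          simp only [fwdDiff, hf]
          rw [add_assoc, hq_block j hj i (by omega), hq_block j hj (i + 1) (by omega)]
        · simp only [hv, if_pos hj, hB]
      · have h4 : e j + m + 1 = e (j + 1) := by omega
        simp only [fwdDiff, h4]
        rw [add_comm (B * v j)]
        exact (abs_sub _ _).trans
          (add_le_add (hf_start (j + 1) hj) (hf_block j hj m (by omega)))
    have hvsum : ∑ j ∈ range (n / b), v j ≤ ∑ i ∈ range (n - (r + 1)), |(Δ_[1])^[r + 1] g i| := by
      set h : ℕ → ℝ := fun i => if i < n - (r + 1) then |(Δ_[1])^[r + 1] g i| else 0 with hh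
      have hh0 : ∀ i, 0 ≤ h i := fun i => by simp only [hh]; split_ifs <;> positivity
      calc _ ≤ ∑ j ∈ range (n / b), ∑ i ∈ range (e (j + 1) - e j), h (e j + i) := by
            refine sum_le_sum fun j hj => ?_
            have hj := mem_range.1 hj
            have hje : e (j + 1) ≤ n := heM ▸ hem hj
            simp only [hv, if_pos hj]
            refine le_trans (sum_le_sum (g := fun i => h (e j + i)) fun i hi => ?_)
              (sum_le_sum_of_subset_of_nonneg (range_mono (Nat.sub_le _ _)) fun _ _ _ => hh0 _)
            have hi := mem_range.1 hi
            simp only [hh]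
            rw [if_pos (by omega)]
        _ = ∑ i ∈ range n, h i := by rw [← sum_range_eq_sum_blocks he0 hem h, heM]
        _ = ∑ i ∈ range (n - (r + 1)), h i := by
            refine (sum_subset (range_mono (Nat.sub_le _ _)) fun i _ hi => ?_).symm
            simp only [hh, if_neg (mt mem_range.2 hi)]
        _ = _ := sum_congr rfl fun i hi => by simp only [hh, if_pos (mem_range.1 hi)]
    have hvshift : ∑ j ∈ range (n / b), v (j + 1) ≤ ∑ j ∈ range (n / b), v j := by
      have h1 := sum_range_succ' v (n / b)
      rw [sum_range_succ] at h1
      have h2 : v (n / b) = 0 := by simp [hv]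
      have := hv0 0
      linarith
    calc _ ≤ _ := hN
      _ = ∑ j ∈ range (n / b), ∑ i ∈ range (e (j + 1) - e j), |Δ_[1] f (e j + i)| := by
          rw [← sum_range_eq_sum_blocks he0 hem (fun i => |Δ_[1] f i|), heM]
      _ ≤ ∑ j ∈ range (n / b), (B * v j + (B * v j + B * v (j + 1))) :=
          sum_le_sum fun j hj => hblock j (mem_range.1 hj)
      _ = B * (2 * ∑ j ∈ range (n / b), v j + ∑ j ∈ range (n / b), v (j + 1)) := by
          rw [sum_add_distrib, sum_add_distrib, ← mul_sum, ← mul_sum]; ring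
      _ ≤ B * (3 * ∑ i ∈ range (n - (r + 1)), |(Δ_[1])^[r + 1] g i|) := by
          gcongr; linarith
      _ = 3 * (C * 2 ^ r) * ((b : ℝ) ^ r * ∑ i ∈ range (n - (r + 1)), |(Δ_[1])^[r + 1] g i|) := by
          rw [hB]; push_cast; ring
      _ ≤ _ := by
          gcongr
          linarith

end TrendFiltering

/-! ### Haar transform and finite-dimensional projections. -/

namespace TrendFiltering

open Finset fwdDiff

/-- The Haar low-pass step. -/
noncomputable def haarLow : (ℕ → ℝ) →ₗ[ℝ] (ℕ → ℝ) where
  toFun u j := (u (2 * j) + u (2 * j + 1)) / √2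
  map_add' u w := by funext j; simp only [Pi.add_apply]; ring
  map_smul' c u := by funext j; simp only [Pi.smul_apply, smul_eq_mul, RingHom.id_apply]; ring

/-- The Haar high-pass step. -/
noncomputable def haarHigh : (ℕ → ℝ) →ₗ[ℝ] (ℕ → ℝ) where
  toFun u j := (u (2 * j) - u (2 * j + 1)) / √2
  map_add' u w := by funext j; simp only [Pi.add_apply]; ring
  map_smul' c u := by funext j; simp only [Pi.smul_apply, smul_eq_mul, RingHom.id_apply]; ring

lemma haarLow_apply (u : ℕ → ℝ) (j : ℕ) : haarLow u j = (u (2 * j) + u (2 * j + 1)) / √2 := rfl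

lemma haarHigh_apply (u : ℕ → ℝ) (j : ℕ) : haarHigh u j = (u (2 * j) - u (2 * j + 1)) / √2 := rfl

lemma sum_mul_eq_haar_step (u w : ℕ → ℝ) (N : ℕ) :
    ∑ i ∈ range (2 * N), u i * w i =
      ∑ j ∈ range N, haarLow u j * haarLow w j + ∑ j ∈ range N, haarHigh u j * haarHigh w j := by
  induction N with
  | zero => simp
  | succ N ih =>
    rw [mul_add, mul_one, sum_range_succ, sum_range_succ, ih, sum_range_succ, sum_range_succ]
    simp only [haarLow_apply, haarHigh_apply]
    have h2 : √2 * √2 = (2 : ℝ) := Real.mul_self_sqrt (by norm_num)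
    have h0 : √2 ≠ (0 : ℝ) := by positivity
    field_simp
    rw [show √2 ^ 2 = (2 : ℝ) by rw [sq]; exact h2]
    ring

/-- Parseval identity of the Haar transform with `κ` levels. -/
lemma sum_mul_eq_haar (κ N : ℕ) (u w : ℕ → ℝ) :
    ∑ i ∈ range (2 ^ κ * N), u i * w i =
      ∑ j ∈ range N, (haarLow ^ κ) u j * (haarLow ^ κ) w j +
        ∑ l ∈ range κ, ∑ j ∈ range (2 ^ l * N),
          haarHigh ((haarLow ^ (κ - 1 - l)) u) j * haarHigh ((haarLow ^ (κ - 1 - l)) w) j := by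
  induction κ generalizing u w with
  | zero => simp
  | succ κ ih =>
    rw [show 2 ^ (κ + 1) * N = 2 * (2 ^ κ * N) by ring, sum_mul_eq_haar_step, ih, sum_range_succ]
    simp only [Nat.add_sub_cancel, Nat.sub_self, pow_zero, Module.End.one_apply, pow_succ,
      Module.End.mul_apply]
    rw [add_assoc]
    congr 2
    refine sum_congr rfl fun l hl => ?_
    have : κ - l = (κ - 1 - l) + 1 := by have := mem_range.1 hl; omega
    rw [this, pow_succ]
    rfl

/-- `√2` times a coarse difference combines three consecutive fine differences with weights 1, 2, 1.
Over all cells each fine difference receives total weight at most 2, and `2 / √2 = √2`. -/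
lemma sum_abs_fwdDiff_haarLow_le {u : ℕ → ℝ} {W : ℝ} (hu : ∀ N, ∑ i ∈ range N, |Δ_[1] u i| ≤ W)
    (N : ℕ) : ∑ j ∈ range N, |Δ_[1] (haarLow u) j| ≤ √2 * W := by
  have h0 : (0 : ℝ) < √2 := by positivity
  have h2 : √2 * √2 = (2 : ℝ) := Real.mul_self_sqrt (by norm_num)
  have key : ∀ (a : ℕ → ℝ) (N : ℕ), ∑ j ∈ range N, (a (2 * j) + 2 * a (2 * j + 1) + a (2 * j + 2)) =
      2 * ∑ i ∈ range (2 * N), a i - a 0 + a (2 * N) := by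
    intro a N
    induction N with
    | zero => simp
    | succ N ih =>
      rw [sum_range_succ, ih, mul_add 2 N 1, mul_one, sum_range_succ, sum_range_succ]; ring
  have h1 : ∀ j, √2 * |Δ_[1] (haarLow u) j| ≤
      |Δ_[1] u (2 * j)| + 2 * |Δ_[1] u (2 * j + 1)| + |Δ_[1] u (2 * j + 2)| := by
    intro j
    have : √2 * Δ_[1] (haarLow u) j =
        Δ_[1] u (2 * j) + 2 * Δ_[1] u (2 * j + 1) + Δ_[1] u (2 * j + 2) := by
      simp only [fwdDiff, haarLow_apply]
      field_simp
      rw [show 2 * (j + 1) = 2 * j + 1 + 1 by ring, show 2 * j + 2 = 2 * j + 1 + 1 by ring]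
      ring
    have habs : √2 * |Δ_[1] (haarLow u) j| = |√2 * Δ_[1] (haarLow u) j| := by
      rw [abs_mul, abs_of_pos h0]
    rw [habs, this]
    refine (abs_add_le _ _).trans (add_le_add_left ((abs_add_le _ _).trans ?_) _)
    rw [abs_mul, abs_two]
  have h3 : √2 * ∑ j ∈ range N, |Δ_[1] (haarLow u) j| ≤ √2 * (√2 * W) := by
    rw [mul_sum, ← mul_assoc, h2]
    refine (sum_le_sum fun j _ => h1 j).trans ?_
    rw [key (fun i => |Δ_[1] u i|)]
    have h4 := hu (2 * N + 1)
    rw [sum_range_succ] at h4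
    have h5 := abs_nonneg (Δ_[1] u 0)
    have h6 := abs_nonneg (Δ_[1] u (2 * N))
    linarith
  exact le_of_mul_le_mul_left h3 h0

lemma sum_abs_fwdDiff_haarLow_pow_le {u : ℕ → ℝ} {W : ℝ}
    (hu : ∀ N, ∑ i ∈ range N, |Δ_[1] u i| ≤ W) (k N : ℕ) :
    ∑ j ∈ range N, |Δ_[1] ((haarLow ^ k) u) j| ≤ √2 ^ k * W := by
  induction k generalizing N with
  | zero => simpa using hu N
  | succ k ih =>
    rw [pow_succ', pow_succ', mul_assoc]
    exact sum_abs_fwdDiff_haarLow_le ih N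

lemma sum_abs_haarHigh_le {u : ℕ → ℝ} {W : ℝ} (hu : ∀ N, ∑ i ∈ range N, |Δ_[1] u i| ≤ W) (N : ℕ) :
    ∑ j ∈ range N, |haarHigh u j| ≤ W := by
  refine le_trans (sum_le_sum (g := fun j => |Δ_[1] u (2 * j)|) fun j _ => ?_)
    (le_trans ?_ (hu (2 * N)))
  · rw [haarHigh_apply, abs_div, fwdDiff, abs_sub_comm]
    refine div_le_self (abs_nonneg _) ?_
    rw [abs_of_pos (by positivity)]
    exact Real.one_le_sqrt.2 (by norm_num)
  · induction N with
    | zero => simp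
    | succ N ih =>
      rw [mul_add, mul_one, sum_range_succ, sum_range_succ, sum_range_succ]
      have := abs_nonneg (Δ_[1] u (2 * N + 1))
      linarith

/-- Extension by zero of a finite vector to a sequence. -/
noncomputable def extendZero (n : ℕ) : (Fin n → ℝ) →ₗ[ℝ] (ℕ → ℝ) where
  toFun u i := if h : i < n then u ⟨i, h⟩ else 0
  map_add' u w := by funext j; simp only [Pi.add_apply]; split_ifs <;> simp
  map_smul' c u := by
    funext j; simp only [Pi.smul_apply, smul_eq_mul, RingHom.id_apply]; split_ifs <;> simp

variable {n : ℕ}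

lemma extendZero_of_le (u : Fin n → ℝ) {i : ℕ} (hi : n ≤ i) : extendZero n u i = 0 :=
  dif_neg (by omega)

lemma extendZero_val (u : Fin n → ℝ) (i : Fin n) : extendZero n u i = u i := dif_pos i.2

/-- For `i < n - r` the stencil of the `r`-th difference stays inside `[0, n)`, so the zero
extension is not seen. -/
lemma iterDiff_eq_fwdDiff (u : Fin n → ℝ) (r : ℕ) (i : Fin (n - r)) :
    iterDiff u r i = (Δ_[1])^[r] (extendZero n u) i := by
  induction r with
  | zero => exact (extendZero_val u i).symm
  | succ r ih =>
    rw [Function.iterate_succ_apply' (fwdDiff 1)]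
    simp only [iterDiff, firstDiff, fwdDiff, ih]

lemma sum_abs_iterDiff (u : Fin n → ℝ) (r : ℕ) :
    ∑ i, |iterDiff u r i| = ∑ i ∈ range (n - r), |(Δ_[1])^[r] (extendZero n u) i| := by
  simp only [iterDiff_eq_fwdDiff]
  exact Fin.sum_univ_eq_sum_range (fun i => |(Δ_[1])^[r] (extendZero n u) i|) (n - r)

lemma sum_extendZero_mul (u w : Fin n → ℝ) {m : ℕ} (hm : n ≤ m) :
    ∑ i ∈ range m, extendZero n u i * extendZero n w i = ∑ i, u i * w i := by
  rw [← sum_subset (range_mono hm) fun i _ hi => by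
    rw [extendZero_of_le u (by simpa using hi), zero_mul]]
  rw [← Fin.sum_univ_eq_sum_range (fun i => extendZero n u i * extendZero n w i)]
  simp only [extendZero_val]

/-- A finite-dimensional space of vectors has an orthonormal family reproducing inner products. -/
lemma exists_orthonormal_functionals {ι : Type*} [Fintype ι] (Φ : ι → Fin n → ℝ) :
    ∃ (d : ℕ) (X : Fin d → (Fin n → ℝ) →ₗ[ℝ] ℝ), d ≤ Fintype.card ι ∧
      (∀ u, ∑ a, X a u ^ 2 ≤ ∑ i, u i ^ 2) ∧
      ∀ q ∈ Submodule.span ℝ (Set.range Φ), ∀ u, ∑ i, u i * q i = ∑ a, X a u * X a q := by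
  let T : (Fin n → ℝ) ≃ₗ[ℝ] EuclideanSpace ℝ (Fin n) := (WithLp.linearEquiv 2 ℝ (Fin n → ℝ)).symm
  let V : Submodule ℝ (EuclideanSpace ℝ (Fin n)) := Submodule.span ℝ (Set.range fun j => T (Φ j))
  let e := stdOrthonormalBasis ℝ V
  have hinner : ∀ u w : Fin n → ℝ, inner ℝ (T u) (T w) = ∑ i, u i * w i := fun u w => by
    simp [PiLp.inner_apply, T, mul_comm]
  refine ⟨Module.finrank ℝ V, fun a => (innerₛₗ ℝ (e a : EuclideanSpace ℝ (Fin n))) ∘ₗ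
    T.toLinearMap, finrank_range_le_card _, fun u => ?_, fun q hq u => ?_⟩
  · have ho : Orthonormal ℝ fun a => (e a : EuclideanSpace ℝ (Fin n)) :=
      e.orthonormal.comp_linearIsometry V.subtypeₗᵢ
    have := ho.sum_inner_products_le (T u) (s := univ)
    simp only [Real.norm_eq_abs, sq_abs] at this
    refine this.trans (le_of_eq ?_)
    rw [← real_inner_self_eq_norm_sq, hinner]
    simp [sq]
  · have hqV : T q ∈ V := by
      have h := Submodule.mem_map_of_mem (f := T.toLinearMap) hq
      rw [Submodule.map_span, ← Set.range_comp] at h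
      exact h
    have h := e.sum_repr ⟨T q, hqV⟩
    have h' : T q = ∑ a, inner ℝ (e a : EuclideanSpace ℝ (Fin n)) (T q) •
        (e a : EuclideanSpace ℝ (Fin n)) := by
      have h2 := congrArg (Submodule.subtype V) h
      rw [map_sum] at h2
      simpa [e.repr_apply_apply] using h2.symm
    rw [← hinner]
    conv_lhs => rw [h']
    rw [inner_sum]
    refine sum_congr rfl fun a _ => ?_
    rw [inner_smul_right, real_inner_comm (e a : EuclideanSpace ℝ (Fin n)) (T u), mul_comm]
    rfl

end TrendFiltering

/-! ### Multiscale control of the noise inner product. -/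

namespace TrendFiltering

open Finset fwdDiff

/-- Since `|x| ≤ (|x| - s)₊ + s`, the excess goes through Cauchy–Schwarz and the rest is paid by a
weighted `ℓ¹` norm of `d`. -/
lemma sum_mul_le_sqrt_excess {A : Type*} [Fintype A] (x d s : A → ℝ) :
    ∑ a, x a * d a ≤ √(∑ a, (max (|x a| - s a) 0) ^ 2) * √(∑ a, d a ^ 2) + ∑ a, s a * |d a| := by
  calc ∑ a, x a * d a ≤ ∑ a, (max (|x a| - s a) 0 * |d a| + s a * |d a|) := by
        refine sum_le_sum fun a _ => ?_
        rw [← add_mul]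
        refine (le_abs_self _).trans ?_
        rw [abs_mul]
        gcongr
        linarith [le_max_left (|x a| - s a) 0]
    _ = ∑ a, max (|x a| - s a) 0 * |d a| + ∑ a, s a * |d a| := sum_add_distrib
    _ ≤ _ := by
        gcongr
        have := Real.sum_mul_le_sqrt_mul_sqrt univ (fun a => max (|x a| - s a) 0) (fun a => |d a|)
        simpa only [sq_abs] using this

variable {n : ℕ}

/-- Index set of the coefficients of a Haar transform with `κ` levels and `N` coarse cells. -/
abbrev HaarIndex (κ N : ℕ) : Type := Fin N ⊕ (Σ l : Fin κ, Fin (2 ^ (l : ℕ) * N))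

/-- The Haar coefficients of a vector, as linear functionals. -/
noncomputable def haarCoeff (n κ N : ℕ) : HaarIndex κ N → (Fin n → ℝ) →ₗ[ℝ] ℝ
  | Sum.inl j => LinearMap.proj (j : ℕ) ∘ₗ (haarLow ^ κ) ∘ₗ extendZero n
  | Sum.inr p => LinearMap.proj (p.2 : ℕ) ∘ₗ haarHigh ∘ₗ (haarLow ^ (κ - 1 - p.1)) ∘ₗ extendZero n

/-- Thresholds for the Haar coefficients, growing linearly with the level. -/
def haarThreshold (κ N : ℕ) : HaarIndex κ N → ℝ
  | Sum.inl _ => 0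
  | Sum.inr p => 2 * ((p.1 : ℕ) : ℝ)

lemma sum_haarCoeff_mul {κ N : ℕ} (hN : n ≤ 2 ^ κ * N) (u w : Fin n → ℝ) :
    ∑ a, haarCoeff n κ N a u * haarCoeff n κ N a w = ∑ i, u i * w i := by
  rw [← sum_extendZero_mul u w hN, sum_mul_eq_haar, Fintype.sum_sum_type, Fintype.sum_sigma]
  congr 1
  · exact Fin.sum_univ_eq_sum_range (fun j => (haarLow ^ κ) (extendZero n u) j *
      (haarLow ^ κ) (extendZero n w) j) N
  · rw [← Fin.sum_univ_eq_sum_range]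
    refine sum_congr rfl fun l _ => ?_
    exact Fin.sum_univ_eq_sum_range (fun j => haarHigh ((haarLow ^ (κ - 1 - l)) (extendZero n u)) j *
      haarHigh ((haarLow ^ (κ - 1 - l)) (extendZero n w)) j) (2 ^ (l : ℕ) * N)

lemma exp_neg_two_le : Real.exp (-2) ≤ 1 / 4 := by
  have h := Real.add_one_le_exp 1
  have h2 : Real.exp 2 = Real.exp 1 * Real.exp 1 := by rw [← Real.exp_add]; norm_num
  rw [Real.exp_neg, h2, inv_eq_one_div]
  exact one_div_le_one_div_of_le (by norm_num) (by nlinarith)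

/-- Level `l` has `2 ^ l * N` coefficients, each contributing `exp (-2 l²) ≤ 4 ^ (-l)`, for a total
of at most `2 N`; the coarse coefficients, with threshold zero, add `N`. -/
lemma sum_exp_haarThreshold_le (κ N : ℕ) :
    ∑ a, Real.exp (-(haarThreshold κ N a) ^ 2 / 2) ≤ 3 * N := by
  have hexp : ∀ l : ℕ, Real.exp (-(2 * (l : ℝ)) ^ 2 / 2) ≤ (1 / 4) ^ l := fun l => by
    have hl : (l : ℝ) ≤ (l : ℝ) ^ 2 := by exact_mod_cast Nat.le_self_pow (by norm_num) l
    calc Real.exp (-(2 * (l : ℝ)) ^ 2 / 2) ≤ Real.exp (l * (-2)) := by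
          apply Real.exp_le_exp.2; nlinarith
      _ = Real.exp (-2) ^ l := Real.exp_nat_mul _ _
      _ ≤ _ := by gcongr; exact exp_neg_two_le
  rw [Fintype.sum_sum_type, Fintype.sum_sigma]
  simp only [haarThreshold]
  have h1 : ∑ l : Fin κ, ∑ _j : Fin (2 ^ (l : ℕ) * N), Real.exp (-(2 * ((l : ℕ) : ℝ)) ^ 2 / 2) ≤
      2 * N := by
    calc _ ≤ ∑ l : Fin κ, (N : ℝ) * (1 / 2) ^ (l : ℕ) := by
          refine sum_le_sum fun l _ => ?_
          rw [sum_const, card_univ, Fintype.card_fin, nsmul_eq_mul]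
          push_cast
          calc _ ≤ 2 ^ (l : ℕ) * (N : ℝ) * (1 / 4) ^ (l : ℕ) := by gcongr; exact hexp l
            _ = N * (2 * (1 / 4)) ^ (l : ℕ) := by rw [mul_pow]; ring
            _ = _ := by norm_num
      _ = N * ∑ l ∈ range κ, (1 / 2 : ℝ) ^ l := by
          rw [← mul_sum, Fin.sum_univ_eq_sum_range (fun l => (1 / 2 : ℝ) ^ l)]
      _ ≤ N * 2 := by gcongr; exact sum_geometric_two_le κ
      _ = _ := mul_comm _ _
  have h2 : ∑ _j : Fin N, Real.exp (-(0 : ℝ) ^ 2 / 2) = N := by simp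
  rw [h2]
  linarith

lemma summable_haarThreshold : Summable fun l : ℕ => (l : ℝ) * (√2)⁻¹ ^ l := by
  have h : ‖(√2)⁻¹‖ < 1 := by
    rw [norm_inv, Real.norm_of_nonneg (by positivity)]
    exact inv_lt_one_of_one_lt₀ (Real.lt_sqrt_of_sq_lt (by norm_num))
  simpa using summable_pow_mul_geometric_of_norm_lt_one 1 h

/-- The details at level `l` have `ℓ¹` norm at most `√2 ^ (κ - 1 - l) * W`; linear thresholds are
summable against this decay, so `T` does not depend on `κ`. -/
lemma exists_sum_haarThreshold_mul_le : ∃ T : ℝ, 0 ≤ T ∧ ∀ (n κ N : ℕ) (u : Fin n → ℝ) (W : ℝ),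
    (∀ M, ∑ i ∈ range M, |Δ_[1] (extendZero n u) i| ≤ W) →
      ∑ a, haarThreshold κ N a * |haarCoeff n κ N a u| ≤ T * (√2 ^ κ * W) := by
  refine ⟨2 * ∑' l : ℕ, (l : ℝ) * (√2)⁻¹ ^ l, by positivity, fun n κ N u W hW => ?_⟩
  have hW0 : 0 ≤ W := by simpa using hW 0
  have h0 : (0 : ℝ) < √2 := by positivity
  have h1 : (1 : ℝ) ≤ √2 := Real.one_le_sqrt.2 (by norm_num)
  rw [Fintype.sum_sum_type, Fintype.sum_sigma]
  simp only [haarThreshold, zero_mul, sum_const_zero, zero_add]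
  calc _ ≤ ∑ l : Fin κ, 2 * (√2 ^ κ * W) * (((l : ℕ) : ℝ) * (√2)⁻¹ ^ (l : ℕ)) := by
        refine sum_le_sum fun l _ => ?_
        rw [← mul_sum]
        have h2 := sum_abs_haarHigh_le
          (sum_abs_fwdDiff_haarLow_pow_le hW (κ - 1 - l)) (2 ^ (l : ℕ) * N)
        rw [← Fin.sum_univ_eq_sum_range] at h2
        have h3 : √2 ^ (κ - 1 - (l : ℕ)) ≤ √2 ^ κ * (√2)⁻¹ ^ (l : ℕ) := by
          rw [inv_pow, ← div_eq_mul_inv, le_div_iff₀ (by positivity), ← pow_add]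
          exact pow_le_pow_right₀ h1 (by have := l.2; omega)
        calc _ ≤ 2 * ((l : ℕ) : ℝ) * (√2 ^ (κ - 1 - (l : ℕ)) * W) := by gcongr; exact h2
          _ ≤ 2 * ((l : ℕ) : ℝ) * (√2 ^ κ * (√2)⁻¹ ^ (l : ℕ) * W) := by gcongr
          _ = _ := by ring
    _ = 2 * (√2 ^ κ * W) * ∑ l ∈ range κ, (l : ℝ) * (√2)⁻¹ ^ l := by
        rw [← mul_sum, Fin.sum_univ_eq_sum_range (fun l => (l : ℝ) * (√2)⁻¹ ^ l)]
    _ ≤ 2 * (√2 ^ κ * W) * ∑' l : ℕ, (l : ℝ) * (√2)⁻¹ ^ l := by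
        gcongr
        exact summable_haarThreshold.sum_le_tsum _ fun l _ => by positivity
    _ = _ := by ring

/-- A Bessel system with thresholds for which the inner product `⟨ε, δ⟩` is controlled by the
truncated coefficients of `ε`, the norm of `δ` and the `ℓ¹` norm of the `(r + 1)`-st difference of
`δ`. -/
theorem exists_multiscale_functionals (r : ℕ) : ∃ C : ℝ, 0 ≤ C ∧
    ∀ n κ : ℕ, r + 1 ≤ κ → 2 ^ κ ≤ n → ∃ (A : Type) (_ : Fintype A)
      (X : A → (Fin n → ℝ) →ₗ[ℝ] ℝ) (s : A → ℝ), (∀ a, 0 ≤ s a) ∧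
      (∀ u, ∑ a, X a u ^ 2 ≤ 2 * ∑ i, u i ^ 2) ∧
      ∑ a, Real.exp (-(s a) ^ 2 / 2) ≤ C * ((n : ℝ) / 2 ^ κ) ∧
      ∀ ε δ : Fin n → ℝ, ∑ i, ε i * δ i ≤
        C * √(∑ a, (max (|X a ε| - s a) 0) ^ 2) * √(∑ i, δ i ^ 2) +
        C * (√2 ^ κ * ((2 ^ κ) ^ r * ∑ i, |iterDiff δ (r + 1) i|)) := by
  obtain ⟨C, hC, hq⟩ := exists_piecewise_approx r
  obtain ⟨T, hT, hThr⟩ := exists_sum_haarThreshold_mul_le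
  -- `√(2 + 3 * C)` bounds the coefficients of both pieces of `δ`, `T * C` the thresholded part, and
  -- `r + 7 = (r + 1) + 6` counts the projection coordinates together with `3 N ≤ 6 n / 2 ^ κ`.
  refine ⟨√(2 + 3 * C) + T * C + (r + 7), by positivity, fun n κ hκ hn => ?_⟩
  have hb0 : 0 < 2 ^ κ := by positivity
  set N := n / 2 ^ κ + 1 with hN
  have hnN : n ≤ 2 ^ κ * N := (Nat.lt_mul_div_succ n hb0).le
  obtain ⟨d, Y, hd, hY, hYq⟩ := exists_orthonormal_functionals
    (fun (p : Fin (n / 2 ^ κ) × Fin (r + 1)) (i : Fin n) =>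
      blockMonomial (breakpoint n (2 ^ κ) p.1) (breakpoint n (2 ^ κ) (p.1 + 1)) p.2 i)
  refine ⟨Fin d ⊕ HaarIndex κ N, inferInstance, Sum.elim Y (haarCoeff n κ N),
    Sum.elim (fun _ => 0) (haarThreshold κ N), ?_, fun u => ?_, ?_, fun ε δ => ?_⟩
  · rintro (a | a | a) <;> simp [haarThreshold]
  · rw [Fintype.sum_sum_type]
    simp only [Sum.elim_inl, Sum.elim_inr]
    have h1 := sum_haarCoeff_mul hnN u u
    simp only [← sq] at h1
    rw [h1]
    linarith [hY u]
  · rw [Fintype.sum_sum_type]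
    simp only [Sum.elim_inl, Sum.elim_inr]
    have h1 := sum_exp_haarThreshold_le κ N
    have h2 : ∑ _a : Fin d, Real.exp (-(0 : ℝ) ^ 2 / 2) = d := by simp
    rw [h2]
    have h3 : ((n / 2 ^ κ : ℕ) : ℝ) ≤ (n : ℝ) / 2 ^ κ := by
      simpa using Nat.cast_div_le (α := ℝ) (m := n) (n := 2 ^ κ)
    have h4 : (1 : ℝ) ≤ (n : ℝ) / 2 ^ κ := by
      rw [le_div_iff₀ (by positivity), one_mul]; exact_mod_cast hn
    have h5 : (d : ℝ) ≤ ((n / 2 ^ κ : ℕ) : ℝ) * (r + 1) := by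
      simp only [Fintype.card_prod, Fintype.card_fin] at hd
      exact_mod_cast hd
    have h6 : (N : ℝ) = ((n / 2 ^ κ : ℕ) : ℝ) + 1 := by rw [hN]; push_cast; rfl
    have h7 : ((n / 2 ^ κ : ℕ) : ℝ) * (r + 1) ≤ (n : ℝ) / 2 ^ κ * (r + 1) := by gcongr
    have h8 : (0 : ℝ) ≤ (√(2 + 3 * C) + T * C) * ((n : ℝ) / 2 ^ κ) := by positivity
    rw [h6] at h1
    nlinarith
  · obtain ⟨q, hqV, hq0, hq2, hqvar⟩ := hq n (2 ^ κ) (Nat.pow_le_pow_right (by norm_num) hκ) hn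
      (extendZero n δ) fun i hi => extendZero_of_le δ hi
    set v := ∑ i, |iterDiff δ (r + 1) i| with hv
    rw [← sum_abs_iterDiff, ← hv] at hqvar
    set p : Fin n → ℝ := fun i => q i with hp
    have hpV : p ∈ Submodule.span ℝ (Set.range fun (p : Fin (n / 2 ^ κ) × Fin (r + 1))
        (i : Fin n) => blockMonomial (breakpoint n (2 ^ κ) p.1)
          (breakpoint n (2 ^ κ) (p.1 + 1)) p.2 i) := by
      have h := Submodule.mem_map_of_mem
        (f := LinearMap.funLeft ℝ ℝ (Fin.val : Fin n → ℕ)) hqV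
      rw [Submodule.map_span, ← Set.range_comp] at h
      exact h
    have hext : extendZero n (δ - p) = fun i => extendZero n δ i - q i := by
      funext i
      rw [map_sub, Pi.sub_apply]
      congr 1
      rcases lt_or_ge i n with h | h
      · exact extendZero_val p ⟨i, h⟩
      · rw [extendZero_of_le _ h, hq0 i h]
    have hp2 : ∑ i, p i ^ 2 ≤ C * ∑ i, δ i ^ 2 := by
      have h1 := sum_extendZero_mul δ δ le_rfl
      have h2 := Fin.sum_univ_eq_sum_range (fun i => q i ^ 2) n
      simp only [← sq] at h1
      rw [h2, ← h1]
      exact hq2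
    have hf2 : ∑ i, (δ - p) i ^ 2 ≤ 2 * ∑ i, δ i ^ 2 + 2 * ∑ i, p i ^ 2 := by
      rw [mul_sum, mul_sum, ← sum_add_distrib]
      refine sum_le_sum fun i _ => ?_
      simp only [Pi.sub_apply]
      nlinarith [sq_nonneg (δ i + p i)]
    -- The polynomial part is read in the projection coordinates, without threshold, and the
    -- remainder in the Haar coordinates.
    set dd : Fin d ⊕ HaarIndex κ N → ℝ :=
      Sum.elim (fun a => Y a p) (fun a => haarCoeff n κ N a (δ - p)) with hdd
    have hinner : ∑ i, ε i * δ i = ∑ a, (Sum.elim Y (haarCoeff n κ N) a) ε * dd a := by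
      rw [Fintype.sum_sum_type]
      simp only [Sum.elim_inl, Sum.elim_inr, hdd]
      rw [sum_haarCoeff_mul hnN, ← hYq p hpV, ← sum_add_distrib]
      refine sum_congr rfl fun i _ => ?_
      simp only [Pi.sub_apply]; ring
    have hdd2 : ∑ a, dd a ^ 2 ≤ (2 + 3 * C) * ∑ i, δ i ^ 2 := by
      rw [Fintype.sum_sum_type]
      simp only [Sum.elim_inl, Sum.elim_inr, hdd]
      have h1 := sum_haarCoeff_mul hnN (δ - p) (δ - p)
      simp only [← sq] at h1
      rw [h1]
      have := hY p
      linarith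
    have hthr : ∑ a, Sum.elim (fun _ => 0) (haarThreshold κ N) a * |dd a| ≤
        T * (√2 ^ κ * (C * ((2 ^ κ) ^ r * v))) := by
      rw [Fintype.sum_sum_type]
      simp only [Sum.elim_inl, Sum.elim_inr, hdd, zero_mul, sum_const_zero, zero_add]
      refine hThr n κ N (δ - p) _ fun M => ?_
      rw [hext]
      simpa using hqvar M
    rw [hinner]
    refine (sum_mul_le_sqrt_excess _ dd (Sum.elim (fun _ => 0) (haarThreshold κ N))).trans ?_
    have h1 : √(∑ a, dd a ^ 2) ≤ √(2 + 3 * C) * √(∑ i, δ i ^ 2) := by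
      rw [← Real.sqrt_mul (by positivity)]
      exact Real.sqrt_le_sqrt hdd2
    have hv0 : 0 ≤ v := sum_nonneg fun _ _ => abs_nonneg _
    set S := √(∑ a, (max (|(Sum.elim Y (haarCoeff n κ N) a) ε| -
      Sum.elim (fun _ => 0) (haarThreshold κ N) a) 0) ^ 2)
    refine add_le_add ?_ ?_
    · calc S * √(∑ a, dd a ^ 2) ≤ S * (√(2 + 3 * C) * √(∑ i, δ i ^ 2)) := by gcongr
        _ = √(2 + 3 * C) * S * √(∑ i, δ i ^ 2) := by ring
        _ ≤ _ := by
          gcongr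
          have : 0 ≤ T * C := by positivity
          linarith [(Nat.cast_nonneg r : (0 : ℝ) ≤ r)]
    · calc _ ≤ T * (√2 ^ κ * (C * ((2 ^ κ) ^ r * v))) := hthr
        _ = T * C * (√2 ^ κ * ((2 ^ κ) ^ r * v)) := by ring
        _ ≤ _ := by
          gcongr
          have : 0 ≤ √(2 + 3 * C) := by positivity
          linarith [(Nat.cast_nonneg r : (0 : ℝ) ≤ r)]

end TrendFiltering

/-! ### Exponential moments of the truncated energy. -/

namespace TrendFiltering

open Finset

lemma integral_exp_sq_div_four_gaussianReal :
    ∫ x, Real.exp (x ^ 2 / 4) ∂(gaussianReal 0 1) = √2 := by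
  rw [integral_gaussianReal_eq_integral_smul one_ne_zero]
  have h : ∀ x : ℝ, gaussianPDFReal 0 1 x • Real.exp (x ^ 2 / 4) =
      (√(2 * Real.pi))⁻¹ * Real.exp (-(1 / 4) * x ^ 2) := fun x => by
    rw [gaussianPDFReal_def, smul_eq_mul, mul_assoc, ← Real.exp_add]
    simp only [NNReal.coe_one, mul_one, sub_zero]
    congr 2
    ring
  simp only [h]
  rw [integral_const_mul, integral_gaussian, ← Real.sqrt_inv, ← Real.sqrt_mul (by positivity)]
  congr 1
  have := Real.pi_ne_zero
  field_simp
  norm_num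

lemma integrable_exp_sq_div_four_gaussianReal :
    Integrable (fun x => Real.exp (x ^ 2 / 4)) (gaussianReal 0 1) := by
  by_contra h
  have h1 := integral_exp_sq_div_four_gaussianReal
  rw [integral_undef h] at h1
  have : 0 < √(2 : ℝ) := by positivity
  linarith

section Gaussian

variable {ι : Type*} [Fintype ι]

lemma lintegral_pi_prod_ofReal (f : ι → ℝ → ℝ) (hf : ∀ a x, 0 ≤ f a x)
    (hint : ∀ a, Integrable (f a) (gaussianReal 0 1)) :
    ∫⁻ g, ENNReal.ofReal (∏ a, f a (g a)) ∂(Measure.pi fun _ : ι => gaussianReal 0 1) =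
      ENNReal.ofReal (∏ a, ∫ x, f a x ∂(gaussianReal 0 1)) := by
  rw [← ofReal_integral_eq_lintegral_ofReal (Integrable.fintype_prod hint)
    (Eventually.of_forall fun g => prod_nonneg fun a _ => hf a _), integral_fintype_prod_eq_prod]

lemma lintegral_exp_sum_mul_gaussian (x : ι → ℝ) :
    ∫⁻ g, ENNReal.ofReal (Real.exp (∑ a, g a * x a)) ∂(Measure.pi fun _ : ι => gaussianReal 0 1) =
      ENNReal.ofReal (Real.exp (∑ a, x a ^ 2 / 2)) := by
  simp only [Real.exp_sum]
  rw [lintegral_pi_prod_ofReal (fun a g => Real.exp (g * x a)) (fun _ _ => (Real.exp_pos _).le)]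
  · congr 1
    refine prod_congr rfl fun a _ => ?_
    have h := congrFun (mgf_fun_id_gaussianReal (μ := 0) (v := 1)) (x a)
    simp only [mgf] at h
    simp only [mul_comm _ (x a)]
    rw [h]
    congr 1
    simp
  · intro a
    simpa only [mul_comm] using integrable_exp_mul_gaussianReal (μ := 0) (v := 1) (x a)

lemma lintegral_exp_sum_sq_gaussian :
    ∫⁻ g, ENNReal.ofReal (Real.exp (∑ a, g a ^ 2 / 4))
      ∂(Measure.pi fun _ : ι => gaussianReal 0 1) = ENNReal.ofReal (√2 ^ Fintype.card ι) := by
  simp only [Real.exp_sum]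
  rw [lintegral_pi_prod_ofReal (fun a g => Real.exp (g ^ 2 / 4)) (fun _ _ => (Real.exp_pos _).le)
    fun _ => integrable_exp_sq_div_four_gaussianReal]
  simp only [integral_exp_sq_div_four_gaussianReal, prod_const, card_univ]

end Gaussian

variable {n : ℕ}

lemma linearMap_apply_eq_sum (X : (Fin n → ℝ) →ₗ[ℝ] ℝ) (u : Fin n → ℝ) :
    X u = ∑ i, X (Pi.single i 1) * u i := by
  rw [LinearMap.pi_apply_eq_sum_univ X u]
  refine sum_congr rfl fun i _ => ?_
  rw [smul_eq_mul, mul_comm]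
  congr 2
  funext j
  simp [Pi.single_apply, eq_comm]

/-- The synthesis operator of a Bessel system is bounded. -/
lemma sum_sq_synthesis_le {ι : Type*} [Fintype ι] {X : ι → (Fin n → ℝ) →ₗ[ℝ] ℝ} {B : ℝ}
    (hB : 0 ≤ B) (hX : ∀ u, ∑ a, X a u ^ 2 ≤ B * ∑ i, u i ^ 2) (v : ι → ℝ) :
    ∑ i, (∑ a, v a * X a (Pi.single i 1)) ^ 2 ≤ B * ∑ a, v a ^ 2 := by
  set c : Fin n → ℝ := fun i => ∑ a, v a * X a (Pi.single i 1) with hc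
  have happ : ∀ a, X a c = ∑ i, c i * X a (Pi.single i 1) := fun a => by
    simp only [linearMap_apply_eq_sum (X a) c, mul_comm]
  have h1 : ∑ i, c i ^ 2 = ∑ a, v a * X a c := by
    simp only [happ, mul_sum]
    rw [sum_comm]
    refine sum_congr rfl fun i _ => ?_
    rw [sq]
    conv_lhs => rw [hc]
    simp only
    rw [sum_mul]
    refine sum_congr rfl fun a _ => ?_
    ring
  have h2 : (∑ i, c i ^ 2) ^ 2 ≤ (∑ a, v a ^ 2) * (B * ∑ i, c i ^ 2) := by
    conv_lhs => rw [h1]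
    exact (sum_mul_sq_le_sq_mul_sq _ _ _).trans (by gcongr; exact hX c)
  change ∑ i, c i ^ 2 ≤ _
  rcases (sum_nonneg fun i _ => sq_nonneg (c i) : 0 ≤ ∑ i, c i ^ 2).eq_or_lt with h | h
  · rw [← h]
    positivity
  · nlinarith

variable {Ω : Type*} [MeasurableSpace Ω] {μ : Measure Ω} {ε : Fin n → Ω → ℝ}

lemma lintegral_exp_linear_le (hindep : iIndepFun ε μ)
    (hsub : ∀ i, HasSubgaussianMGF (ε i) (1 / 4) μ) (c : Fin n → ℝ) :
    ∫⁻ ω, ENNReal.ofReal (Real.exp (∑ i, c i * ε i ω)) ∂μ ≤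
      ENNReal.ofReal (Real.exp ((∑ i, c i ^ 2) / 8)) := by
  have hind : iIndepFun (fun i ω => c i * ε i ω) μ :=
    hindep.comp (fun i x => c i * x) fun i => measurable_const_mul _
  have h := HasSubgaussianMGF.sum_of_iIndepFun hind (s := univ)
    (c := fun i => Real.toNNReal (c i ^ 2) * (1 / 4)) fun i _ => by
      rw [Real.toNNReal_of_nonneg (sq_nonneg (c i))]
      exact (hsub i).const_mul (c i)
  have h1 := h.integrable_exp_mul 1
  have h2 := h.mgf_le 1
  simp only [one_mul] at h1
  simp only [mgf, one_mul] at h2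
  rw [← ofReal_integral_eq_lintegral_ofReal h1 (Eventually.of_forall fun _ => (Real.exp_pos _).le)]
  refine ENNReal.ofReal_le_ofReal (h2.trans (le_of_eq ?_))
  congr 1
  push_cast
  simp only [Real.coe_toNNReal _ (sq_nonneg _)]
  rw [← sum_mul]
  ring

variable [IsProbabilityMeasure μ]

/-- Exponential moment of the energy of the coefficients of a sub-Gaussian vector in a Bessel
system with bound `2`. -/
lemma lintegral_exp_sum_sq_le {ι : Type*} [Fintype ι] {X : ι → (Fin n → ℝ) →ₗ[ℝ] ℝ}
    (hX : ∀ u, ∑ a, X a u ^ 2 ≤ 2 * ∑ i, u i ^ 2) (hmeas : ∀ i, Measurable (ε i))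
    (hindep : iIndepFun ε μ) (hsub : ∀ i, HasSubgaussianMGF (ε i) (1 / 4) μ) :
    ∫⁻ ω, ENNReal.ofReal (Real.exp (∑ a, X a (fun i => ε i ω) ^ 2 / 2)) ∂μ ≤
      ENNReal.ofReal (√2 ^ Fintype.card ι) := by
  have hmX : ∀ a, Measurable fun ω => X a fun i => ε i ω := fun a =>
    (X a).continuous_of_finiteDimensional.measurable.comp (measurable_pi_lambda _ hmeas)
  have hfun : ∀ (g : ι → ℝ) (ω : Ω), ∑ a, g a * X a (fun i => ε i ω) =
      ∑ i, (∑ a, g a * X a (Pi.single i 1)) * ε i ω := fun g ω => by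
    simp only [linearMap_apply_eq_sum (X _) (fun i => ε i ω), mul_sum, sum_mul]
    rw [sum_comm]
    refine sum_congr rfl fun i _ => sum_congr rfl fun a _ => by ring
  -- Gaussian linearization: `exp (x² / 2)` is the mean of `exp (g x)`. After exchanging the
  -- integrals, the sub-Gaussian factor `1/8` and the Bessel bound `2` leave the mean of `exp (‖g‖²
  -- / 4)`, which is finite.
  simp only [← lintegral_exp_sum_mul_gaussian]
  rw [lintegral_lintegral_swap]
  · rw [← lintegral_exp_sum_sq_gaussian]
    refine lintegral_mono fun g => ?_
    simp only [hfun]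
    refine (lintegral_exp_linear_le hindep hsub _).trans
      (ENNReal.ofReal_le_ofReal (Real.exp_le_exp.2 ?_))
    have := sum_sq_synthesis_le zero_le_two hX g
    rw [← sum_div]
    linarith
  · refine Measurable.aemeasurable ?_
    refine ENNReal.measurable_ofReal.comp (Real.measurable_exp.comp ?_)
    refine Finset.measurable_sum _ fun a _ => ?_
    exact ((measurable_pi_apply a).comp measurable_snd).mul ((hmX a).comp measurable_fst)

/-- For `|x| ≥ s ≥ 0` one has `(|x| - s)² ≤ x² - s²`; below the threshold the left side is `1`. -/
lemma exp_excess_le {x s : ℝ} (hs : 0 ≤ s) :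
    Real.exp ((max (|x| - s) 0) ^ 2 / 2) ≤ 1 + Real.exp (-s ^ 2 / 2) * Real.exp (x ^ 2 / 2) := by
  rcases le_total (|x| - s) 0 with h | h
  · rw [max_eq_right h]
    simp only [ne_eq, OfNat.ofNat_ne_zero, not_false_eq_true, zero_pow, zero_div, Real.exp_zero]
    have := mul_pos (Real.exp_pos (-s ^ 2 / 2)) (Real.exp_pos (x ^ 2 / 2))
    linarith
  · rw [max_eq_left h, ← Real.exp_add]
    have : Real.exp ((|x| - s) ^ 2 / 2) ≤ Real.exp (-s ^ 2 / 2 + x ^ 2 / 2) := by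
      apply Real.exp_le_exp.2
      nlinarith [sq_abs x]
    linarith

/-- Tail bound for the truncated energy of a sub-Gaussian vector in a Bessel system. -/
theorem measure_excess_ge_le {A : Type*} [Fintype A] {X : A → (Fin n → ℝ) →ₗ[ℝ] ℝ} {s : A → ℝ}
    (hs : ∀ a, 0 ≤ s a) (hX : ∀ u, ∑ a, X a u ^ 2 ≤ 2 * ∑ i, u i ^ 2)
    (hmeas : ∀ i, Measurable (ε i)) (hindep : iIndepFun ε μ)
    (hsub : ∀ i, HasSubgaussianMGF (ε i) (1 / 4) μ) (u : ℝ) :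
    μ {ω | u ≤ ∑ a, (max (|X a fun i => ε i ω| - s a) 0) ^ 2} ≤
      ENNReal.ofReal (Real.exp (2 * ∑ a, Real.exp (-(s a) ^ 2 / 2) - u / 2)) := by
  classical
  have hmX : ∀ a, Measurable fun ω => X a fun i => ε i ω := fun a =>
    (X a).continuous_of_finiteDimensional.measurable.comp (measurable_pi_lambda _ hmeas)
  set S : Ω → ℝ := fun ω => ∑ a, (max (|X a fun i => ε i ω| - s a) 0) ^ 2 with hS
  have hsqrt2 : √2 ≤ (2 : ℝ) := by
    rw [Real.sqrt_le_left (by norm_num)]; norm_num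
  have hexp : ∫⁻ ω, ENNReal.ofReal (Real.exp (S ω / 2)) ∂μ ≤
      ENNReal.ofReal (Real.exp (2 * ∑ a, Real.exp (-(s a) ^ 2 / 2))) := by
    -- The product of the factors `1 + ...` is expanded over subfamilies. Each inherits the Bessel
    -- bound, hence the moment bound `√2 ^ card`, and the sum folds back into a product.
    -- Independence of the coefficients is not needed.
    calc ∫⁻ ω, ENNReal.ofReal (Real.exp (S ω / 2)) ∂μ
        ≤ ∫⁻ ω, ∑ t ∈ (univ : Finset A).powerset,
            ENNReal.ofReal (∏ a ∈ t, Real.exp (-(s a) ^ 2 / 2)) *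
            ENNReal.ofReal (Real.exp (∑ a : t, X a (fun i => ε i ω) ^ 2 / 2)) ∂μ := by
          refine lintegral_mono fun ω => ?_
          have h1 : Real.exp (S ω / 2) ≤ ∑ t ∈ (univ : Finset A).powerset,
              (∏ a ∈ t, Real.exp (-(s a) ^ 2 / 2)) *
                Real.exp (∑ a : t, X a (fun i => ε i ω) ^ 2 / 2) := by
            simp only [hS, sum_div, Real.exp_sum]
            calc _ ≤ ∏ a, (1 + Real.exp (-(s a) ^ 2 / 2) *
                  Real.exp (X a (fun i => ε i ω) ^ 2 / 2)) :=
                  prod_le_prod (fun _ _ => (Real.exp_pos _).le) fun a _ => exp_excess_le (hs a)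
              _ = _ := by
                  rw [prod_one_add]
                  refine sum_congr rfl fun t _ => ?_
                  rw [prod_mul_distrib]
                  congr 1
                  exact (prod_coe_sort t fun a => Real.exp (X a (fun i => ε i ω) ^ 2 / 2)).symm
          refine (ENNReal.ofReal_le_ofReal h1).trans (le_of_eq ?_)
          rw [ENNReal.ofReal_sum_of_nonneg fun t _ => by positivity]
          refine sum_congr rfl fun t _ => ?_
          rw [ENNReal.ofReal_mul (by positivity)]
      _ = ∑ t ∈ (univ : Finset A).powerset, ENNReal.ofReal (∏ a ∈ t, Real.exp (-(s a) ^ 2 / 2)) *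
            ∫⁻ ω, ENNReal.ofReal (Real.exp (∑ a : t, X a (fun i => ε i ω) ^ 2 / 2)) ∂μ := by
          have hm : ∀ t : Finset A, Measurable fun ω =>
              ENNReal.ofReal (Real.exp (∑ a : t, X a (fun i => ε i ω) ^ 2 / 2)) := fun t =>
            ENNReal.measurable_ofReal.comp (Real.measurable_exp.comp
              (Finset.measurable_sum _ fun a _ => ((hmX a).pow_const 2).div_const 2))
          rw [lintegral_finsetSum _ fun t _ => (hm t).const_mul _]
          exact sum_congr rfl fun t _ => lintegral_const_mul _ (hm t)
      _ ≤ ∑ t ∈ (univ : Finset A).powerset, ENNReal.ofReal (∏ a ∈ t, Real.exp (-(s a) ^ 2 / 2)) *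
            ENNReal.ofReal (√2 ^ t.card) := by
          refine sum_le_sum fun t _ => ?_
          gcongr
          have hXt : ∀ u, ∑ a : t, X a u ^ 2 ≤ 2 * ∑ i, u i ^ 2 := fun u =>
            le_trans (by
              rw [sum_coe_sort t fun a => X a u ^ 2]
              exact sum_le_sum_of_subset_of_nonneg (subset_univ t) fun _ _ _ => sq_nonneg _) (hX u)
          have := lintegral_exp_sum_sq_le hXt hmeas hindep hsub
          simpa using this
      _ = ENNReal.ofReal (∏ a, (1 + √2 * Real.exp (-(s a) ^ 2 / 2))) := by
          rw [prod_one_add, ENNReal.ofReal_sum_of_nonneg fun t _ => by positivity]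
          refine sum_congr rfl fun t _ => ?_
          rw [prod_mul_distrib, prod_const, mul_comm, ENNReal.ofReal_mul (by positivity)]
      _ ≤ _ := by
          refine ENNReal.ofReal_le_ofReal ?_
          rw [mul_sum, Real.exp_sum]
          refine prod_le_prod (fun _ _ => by positivity) fun a _ => ?_
          have h1 := Real.add_one_le_exp (2 * Real.exp (-(s a) ^ 2 / 2))
          have h2 := mul_le_mul_of_nonneg_right hsqrt2 (Real.exp_pos (-(s a) ^ 2 / 2)).le
          linarith
  have hmS : Measurable fun ω => ENNReal.ofReal (Real.exp (S ω / 2)) :=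
    ENNReal.measurable_ofReal.comp (Real.measurable_exp.comp
      ((Finset.measurable_sum _ fun a _ =>
        ((((hmX a).abs).sub_const _).max measurable_const).pow_const 2).div_const 2))
  have hmarkov := mul_meas_ge_le_lintegral (μ := μ) hmS (ENNReal.ofReal (Real.exp (u / 2)))
  have hsubset : {ω | u ≤ S ω} ⊆
      {ω | ENNReal.ofReal (Real.exp (u / 2)) ≤ ENNReal.ofReal (Real.exp (S ω / 2))} := fun ω hω =>
    ENNReal.ofReal_le_ofReal (Real.exp_le_exp.2 (by
      have : u ≤ S ω := hω
      linarith))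
  rw [Real.exp_sub, ENNReal.ofReal_div_of_pos (Real.exp_pos _)]
  refine (measure_mono hsubset).trans ?_
  rw [ENNReal.le_div_iff_mul_le (Or.inl (by simp [Real.exp_pos])) (Or.inl ENNReal.ofReal_ne_top),
    mul_comm]
  exact hmarkov.trans hexp

end TrendFiltering

/-! ### Discretization in `t`. -/

namespace TrendFiltering

open Finset

/-- The points whose left and right distribution values lie in `[j, j + 1]`. -/
def quantileCell (ν : Measure ℝ) (j : ℕ) : Set ℝ :=
  {x | (j : ℝ≥0∞) ≤ ν (Set.Iio x) ∧ ν (Set.Iic x) ≤ j + 1}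

lemma measurableSet_quantileCell (ν : Measure ℝ) (j : ℕ) : MeasurableSet (quantileCell ν j) := by
  have h1 : Measurable fun x => ν (Set.Iio x) :=
    Monotone.measurable fun a b hab => measure_mono (Set.Iio_subset_Iio hab)
  have h2 : Measurable fun x => ν (Set.Iic x) :=
    Monotone.measurable fun a b hab => measure_mono (Set.Iic_subset_Iic.2 hab)
  exact (measurableSet_le measurable_const h1).inter (measurableSet_le h2 measurable_const)

/-- By inner regularity it suffices to treat compact `K`. With least point `a` and greatest point
`b`, its mass is at most that of `Iic b` minus that of `Iio a`, hence at most `(j + 1) - j`, even if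
there are atoms. -/
lemma measure_quantileCell_le_one (ν : Measure ℝ) [IsFiniteMeasure ν] (j : ℕ) :
    ν (quantileCell ν j) ≤ 1 := by
  rw [(measurableSet_quantileCell ν j).measure_eq_iSup_isCompact]
  refine iSup_le fun K => iSup_le fun hK => iSup_le fun hKc => ?_
  rcases K.eq_empty_or_nonempty with rfl | hne
  · simp
  obtain ⟨a, ha, hamin⟩ := hKc.exists_isLeast hne
  obtain ⟨b, hb, hbmax⟩ := hKc.exists_isGreatest hne
  have h1 : ν K + ν (Set.Iio a) ≤ ν (Set.Iic b) := by
    rw [← measure_union _ measurableSet_Iio]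
    · refine measure_mono (Set.union_subset (fun x hx => hbmax hx) fun x hx => ?_)
      exact (le_of_lt hx).trans (hbmax ha)
    · exact Set.disjoint_left.2 fun x hx hxa => not_lt.2 (hamin hx) hxa
  have h2 : ν K + j ≤ 1 + j := by
    calc ν K + j ≤ ν K + ν (Set.Iio a) := by gcongr; exact (hK ha).1
      _ ≤ ν (Set.Iic b) := h1
      _ ≤ j + 1 := (hK hb).2
      _ = 1 + j := add_comm _ _
  exact (ENNReal.add_le_add_iff_right (ENNReal.natCast_ne_top j)).1 h2

variable {Ω : Type*} [MeasurableSpace Ω] {μ : Measure Ω} {n : ℕ} {y : Fin n → Ω → ℝ}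

/-- The centred indicator vector `w(t) - F*(t)`. -/
noncomputable def noise (μ : Measure Ω) (y : Fin n → Ω → ℝ) (t : ℝ) (i : Fin n) (ω : Ω) : ℝ :=
  indicatorVec (fun i => y i ω) t i - trueCDF μ y t i

lemma measurable_noise (hy : ∀ i, Measurable (y i)) (t : ℝ) (i : Fin n) :
    Measurable (noise μ y t i) :=
  ((measurable_const.indicator measurableSet_Iic).comp (hy i)).sub_const _

lemma iIndepFun_noise (hindep : iIndepFun y μ) (t : ℝ) : iIndepFun (noise μ y t) μ :=
  hindep.comp (fun i x => Set.indicator (Set.Iic t) (fun _ => (1 : ℝ)) x - trueCDF μ y t i) fun _ =>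
    (measurable_const.indicator measurableSet_Iic).sub_const _

lemma trueCDF_nonneg (t : ℝ) (i : Fin n) : 0 ≤ trueCDF μ y t i := measureReal_nonneg

variable [IsProbabilityMeasure μ]

lemma hasSubgaussianMGF_noise (hy : ∀ i, Measurable (y i)) (t : ℝ) (i : Fin n) :
    HasSubgaussianMGF (noise μ y t i) (1 / 4) μ := by
  have hm : Measurable fun ω => Set.indicator (Set.Iic t) (fun _ => (1 : ℝ)) (y i ω) :=
    (measurable_const.indicator measurableSet_Iic).comp (hy i)
  have h := hasSubgaussianMGF_of_mem_Icc (μ := μ) (a := 0) (b := 1) hm.aemeasurable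
    (Eventually.of_forall fun ω => by
      by_cases h : y i ω ∈ Set.Iic t <;> simp [h])
  have hint : ∫ ω, Set.indicator (Set.Iic t) (fun _ => (1 : ℝ)) (y i ω) ∂μ = trueCDF μ y t i := by
    have := integral_indicator_one (μ := μ) (s := y i ⁻¹' Set.Iic t) (hy i measurableSet_Iic)
    exact this
  rw [hint] at h
  have hvar : (‖(1 : ℝ) - 0‖₊ / 2) ^ 2 = 1 / 4 := by
    rw [sub_zero, nnnorm_one, div_pow]; norm_num
  rw [hvar] at h
  exact h

/-- Number of observations in a set. -/
noncomputable def countIn (y : Fin n → Ω → ℝ) (U : Set ℝ) (ω : Ω) : ℝ :=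
  ∑ i, U.indicator (fun _ => (1 : ℝ)) (y i ω)

/-- Chernoff bound at parameter `1`: as `e ≤ 3`, an indicator of probability `p` has exponential
moment at most `1 + 2 p ≤ exp (2 p)`, and the `p` sum to at most `1`. -/
lemma measure_countIn_ge_le (hy : ∀ i, Measurable (y i)) (hindep : iIndepFun y μ) {U : Set ℝ}
    (hU : MeasurableSet U) (hmass : ∑ i, μ.real (y i ⁻¹' U) ≤ 1) (u : ℝ) :
    μ {ω | u ≤ countIn y U ω} ≤ ENNReal.ofReal (Real.exp (2 - u)) := by
  set Z : Fin n → Ω → ℝ := fun i ω => U.indicator (fun _ => (1 : ℝ)) (y i ω) with hZ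
  have hZm : ∀ i, Measurable (Z i) := fun i => (measurable_const.indicator hU).comp (hy i)
  have hZi : iIndepFun Z μ :=
    hindep.comp (fun i x => U.indicator (fun _ => (1 : ℝ)) x) fun i => measurable_const.indicator hU
  have hZ01 : ∀ i ω, Z i ω ∈ Set.Icc (0 : ℝ) 1 := fun i ω => by
    by_cases h : y i ω ∈ U <;> simp [hZ, h]
  have hmgf : ∀ i, mgf (Z i) μ 1 ≤ Real.exp (2 * μ.real (y i ⁻¹' U)) := by
    intro i
    have hle : ∀ ω, Real.exp (1 * Z i ω) ≤ 1 + 2 * (y i ⁻¹' U).indicator 1 ω := fun ω => by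
      by_cases h : y i ω ∈ U
      · have := Real.exp_one_lt_d9
        simp only [hZ, Set.indicator_of_mem h, mul_one, Set.mem_preimage, h, Set.indicator_of_mem,
          Pi.one_apply]
        linarith
      · simp [hZ, h]
    have hind : Integrable ((y i ⁻¹' U).indicator (1 : Ω → ℝ)) μ :=
      (integrable_const (1 : ℝ)).indicator (hy i hU)
    calc mgf (Z i) μ 1 ≤ ∫ ω, (1 + 2 * (y i ⁻¹' U).indicator 1 ω) ∂μ :=
          integral_mono
            (integrable_exp_mul_of_mem_Icc (hZm i).aemeasurable (Eventually.of_forall (hZ01 i)))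
            ((integrable_const _).add (hind.const_mul 2)) hle
      _ = 1 + 2 * μ.real (y i ⁻¹' U) := by
          rw [integral_add (integrable_const _) (hind.const_mul 2), integral_const_mul,
            integral_indicator_one (hy i hU)]
          simp
      _ ≤ _ := by linarith [Real.add_one_le_exp (2 * μ.real (y i ⁻¹' U))]
  have hsum : mgf (∑ i, Z i) μ 1 ≤ Real.exp 2 := by
    rw [hZi.mgf_sum hZm univ]
    calc _ ≤ ∏ i, Real.exp (2 * μ.real (y i ⁻¹' U)) :=
          prod_le_prod (fun i _ => mgf_nonneg) fun i _ => hmgf i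
      _ = Real.exp (2 * ∑ i, μ.real (y i ⁻¹' U)) := by rw [← Real.exp_sum, mul_sum]
      _ ≤ _ := Real.exp_le_exp.2 (by linarith)
  have hcount : countIn y U = ∑ i, Z i := by
    funext ω; simp [countIn, hZ]
  have hint : Integrable (fun ω => Real.exp (1 * (∑ i, Z i) ω)) μ := by
    refine integrable_exp_mul_of_mem_Icc (a := 0) (b := n)
      (hcount ▸ Finset.measurable_sum _ fun i _ => hZm i : Measurable (∑ i, Z i)).aemeasurable
      (Eventually.of_forall fun ω => ?_)
    rw [Finset.sum_apply]
    exact ⟨sum_nonneg fun i _ => (hZ01 i ω).1, (sum_le_sum fun i _ => (hZ01 i ω).2).trans (by simp)⟩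
  rw [hcount]
  have h := measure_ge_le_exp_mul_mgf (μ := μ) (X := ∑ i, Z i) u zero_le_one hint
  rw [← ofReal_measureReal]
  refine ENNReal.ofReal_le_ofReal (h.trans ?_)
  rw [sub_eq_neg_add, Real.exp_add, neg_one_mul]
  gcongr

/-- The sum of the marginal laws of the sample. -/
noncomputable def totalLaw (μ : Measure Ω) (y : Fin n → Ω → ℝ) : Measure ℝ :=
  ∑ i, μ.map (y i)

instance : IsFiniteMeasure (totalLaw μ y) := by
  unfold totalLaw; infer_instance

lemma totalLaw_apply (hy : ∀ i, Measurable (y i)) {U : Set ℝ} (hU : MeasurableSet U) :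
    totalLaw μ y U = ENNReal.ofReal (∑ i, μ.real (y i ⁻¹' U)) := by
  rw [totalLaw, Measure.finsetSum_apply, ENNReal.ofReal_sum_of_nonneg fun _ _ => measureReal_nonneg]
  exact sum_congr rfl fun i _ => by rw [Measure.map_apply (hy i) hU, ofReal_measureReal]

lemma totalLaw_Iic (hy : ∀ i, Measurable (y i)) (t : ℝ) :
    totalLaw μ y (Set.Iic t) = ENNReal.ofReal (∑ i, trueCDF μ y t i) :=
  totalLaw_apply hy measurableSet_Iic

lemma trueCDF_mono {s t : ℝ} (hst : s ≤ t) (i : Fin n) : trueCDF μ y s i ≤ trueCDF μ y t i :=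
  measureReal_mono fun _ hω => le_trans hω hst

lemma trueCDF_le_one (t : ℝ) (i : Fin n) : trueCDF μ y t i ≤ 1 := measureReal_le_one

/-- An indicator changes only if its observation lies in `(s, t]`, which forces it into the cell.
The mean changes `p` satisfy `p² ≤ p` and sum to at most `1`. -/
lemma sum_sq_noise_sub_le_of_le (hy : ∀ i, Measurable (y i)) {s t : ℝ} (hst : s ≤ t) {j : ℕ}
    (hs : (j : ℝ) ≤ ∑ i, trueCDF μ y s i) (ht : ∑ i, trueCDF μ y t i ≤ j + 1) (ω : Ω) :
    ∑ i, (noise μ y t i ω - noise μ y s i ω) ^ 2 ≤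
      2 * countIn y (quantileCell (totalLaw μ y) j) ω + 2 := by
  set U := quantileCell (totalLaw μ y) j with hU
  have key : ∀ i, (noise μ y t i ω - noise μ y s i ω) ^ 2 ≤
      2 * U.indicator (fun _ => (1 : ℝ)) (y i ω) + 2 * (trueCDF μ y t i - trueCDF μ y s i) := by
    intro i
    have hp0 := sub_nonneg.2 (trueCDF_mono (μ := μ) (y := y) hst i)
    have hp1 : trueCDF μ y t i - trueCDF μ y s i ≤ 1 := by
      linarith [trueCDF_le_one (μ := μ) (y := y) t i, trueCDF_nonneg (μ := μ) (y := y) s i]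
    set p := trueCDF μ y t i - trueCDF μ y s i with hp
    have hp2 : p ^ 2 ≤ p := by nlinarith
    have hind0 : 0 ≤ U.indicator (fun _ => (1 : ℝ)) (y i ω) :=
      Set.indicator_nonneg (fun _ _ => zero_le_one) _
    have heq : noise μ y t i ω - noise μ y s i ω =
        indicatorVec (fun i => y i ω) t i - indicatorVec (fun i => y i ω) s i - p := by
      simp only [noise, hp]; ring
    rw [heq]
    by_cases h1 : y i ω ≤ s
    · have h2 : y i ω ≤ t := h1.trans hst
      simp only [indicatorVec, Set.indicator, Set.mem_Iic, h1, h2, if_true] at hind0 ⊢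
      nlinarith
    · by_cases h2 : y i ω ≤ t
      · have hmem : y i ω ∈ U := by
          constructor
          · calc (j : ℝ≥0∞) = ENNReal.ofReal j := (ENNReal.ofReal_natCast j).symm
              _ ≤ ENNReal.ofReal (∑ i, trueCDF μ y s i) := ENNReal.ofReal_le_ofReal hs
              _ = totalLaw μ y (Set.Iic s) := (totalLaw_Iic hy s).symm
              _ ≤ _ := measure_mono fun x hx => lt_of_le_of_lt hx (not_le.1 h1)
          · calc totalLaw μ y (Set.Iic (y i ω)) ≤ totalLaw μ y (Set.Iic t) :=
                  measure_mono (Set.Iic_subset_Iic.2 h2)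
              _ = ENNReal.ofReal (∑ i, trueCDF μ y t i) := totalLaw_Iic hy t
              _ ≤ ENNReal.ofReal (j + 1) := ENNReal.ofReal_le_ofReal ht
              _ = j + 1 := by
                  rw [ENNReal.ofReal_add (by positivity) zero_le_one, ENNReal.ofReal_natCast,
                    ENNReal.ofReal_one]
        rw [Set.indicator_of_mem hmem]
        simp only [indicatorVec, Set.indicator, Set.mem_Iic, h1, h2, if_true, if_false]
        nlinarith
      · simp only [indicatorVec, Set.indicator, Set.mem_Iic, h1, h2, if_false] at hind0 ⊢
        nlinarith
  calc _ ≤ ∑ i, (2 * U.indicator (fun _ => (1 : ℝ)) (y i ω) +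
        2 * (trueCDF μ y t i - trueCDF μ y s i)) := sum_le_sum fun i _ => key i
    _ = 2 * countIn y U ω + 2 * (∑ i, trueCDF μ y t i - ∑ i, trueCDF μ y s i) := by
        rw [sum_add_distrib, ← mul_sum, ← mul_sum, sum_sub_distrib, countIn]
    _ ≤ _ := by linarith

lemma sum_sq_noise_sub_le (hy : ∀ i, Measurable (y i)) {s t : ℝ}
    (hst : ⌊∑ i, trueCDF μ y s i⌋₊ = ⌊∑ i, trueCDF μ y t i⌋₊) (ω : Ω) :
    ∑ i, (noise μ y t i ω - noise μ y s i ω) ^ 2 ≤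
      2 * countIn y (quantileCell (totalLaw μ y) ⌊∑ i, trueCDF μ y t i⌋₊) ω + 2 := by
  have h0 : ∀ t, 0 ≤ ∑ i, trueCDF μ y t i := fun t => sum_nonneg fun i _ => trueCDF_nonneg t i
  rcases le_total s t with h | h
  · exact sum_sq_noise_sub_le_of_le hy h (hst ▸ Nat.floor_le (h0 s)) (Nat.lt_floor_add_one _).le ω
  · rw [← hst]
    rw [sum_congr rfl fun i _ => sub_sq_comm (noise μ y t i ω) (noise μ y s i ω)]
    exact sum_sq_noise_sub_le_of_le hy h (hst ▸ Nat.floor_le (h0 t)) (Nat.lt_floor_add_one _).le ω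

/-- Uniformly in `t`, outside an event of small probability, the noise at `t` is close to a noise
vector with small truncated energy. -/
theorem measure_noise_bad_le (hy : ∀ i, Measurable (y i)) (hindep : iIndepFun y μ)
    {A : Type*} [Fintype A] {X : A → (Fin n → ℝ) →ₗ[ℝ] ℝ} {s : A → ℝ}
    (hs : ∀ a, 0 ≤ s a) (hX : ∀ u, ∑ a, X a u ^ 2 ≤ 2 * ∑ i, u i ^ 2) (u₁ u₂ : ℝ) :
    μ {ω | ∃ t, ∀ t', ∑ a, (max (|X a fun i => noise μ y t' i ω| - s a) 0) ^ 2 < u₁ →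
        2 * u₂ + 2 < ∑ i, (noise μ y t i ω - noise μ y t' i ω) ^ 2} ≤
      (n + 1) * (ENNReal.ofReal (Real.exp (2 * ∑ a, Real.exp (-(s a) ^ 2 / 2) - u₁ / 2)) +
        ENNReal.ofReal (Real.exp (2 - u₂))) := by
  classical
  set G : ℝ → ℕ := fun t => ⌊∑ i, trueCDF μ y t i⌋₊ with hG
  have hGn : ∀ t, G t < n + 1 := fun t => by
    have h1 : ∑ i, trueCDF μ y t i ≤ n :=
      (sum_le_sum fun i _ => trueCDF_le_one t i).trans (by simp)
    have h2 := Nat.floor_le_floor h1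
    rw [Nat.floor_natCast] at h2
    exact Nat.lt_succ_of_le h2
  -- One representative parameter per nonempty cell; the value at empty cells is arbitrary.
  set τ : ℕ → ℝ := fun j => if h : ∃ t, G t = j then h.choose else 0 with hτ
  have hGτ : ∀ t, G (τ (G t)) = G t := fun t => by
    have h : ∃ t', G t' = G t := ⟨t, rfl⟩
    simp only [hτ, dif_pos h]
    exact h.choose_spec
  have hsub : {ω | ∃ t, ∀ t', ∑ a, (max (|X a fun i => noise μ y t' i ω| - s a) 0) ^ 2 < u₁ →
        2 * u₂ + 2 < ∑ i, (noise μ y t i ω - noise μ y t' i ω) ^ 2} ⊆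
      ⋃ j ∈ range (n + 1), ({ω | u₁ ≤ ∑ a, (max (|X a fun i => noise μ y (τ j) i ω| - s a) 0) ^ 2} ∪
        {ω | u₂ ≤ countIn y (quantileCell (totalLaw μ y) j) ω}) := by
    rintro ω ⟨t, ht⟩
    refine Set.mem_biUnion (mem_range.2 (hGn t)) ?_
    by_contra hcon
    simp only [Set.mem_union, Set.mem_ofPred_eq, not_or, not_le] at hcon
    have h1 := ht (τ (G t)) hcon.1
    have h2 := sum_sq_noise_sub_le hy (hGτ t) ω
    have h3 := hcon.2
    simp only [hG] at h1 h3
    linarith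
  refine (measure_mono hsub).trans ((measure_biUnion_finset_le _ _).trans ?_)
  calc _ ≤ ∑ _j ∈ range (n + 1),
        (ENNReal.ofReal (Real.exp (2 * ∑ a, Real.exp (-(s a) ^ 2 / 2) - u₁ / 2)) +
          ENNReal.ofReal (Real.exp (2 - u₂))) := by
        refine sum_le_sum fun j _ => (measure_union_le _ _).trans (add_le_add ?_ ?_)
        · exact measure_excess_ge_le hs hX (measurable_noise hy (τ j)) (iIndepFun_noise hindep (τ j))
            (hasSubgaussianMGF_noise hy (τ j)) u₁
        · refine measure_countIn_ge_le hy hindep (measurableSet_quantileCell _ j) ?_ u₂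
          have h := measure_quantileCell_le_one (totalLaw μ y) j
          rw [totalLaw_apply hy (measurableSet_quantileCell _ j)] at h
          exact ENNReal.ofReal_le_one.1 h
    _ = _ := by
        rw [sum_const, card_range, nsmul_eq_mul]
        push_cast
        rfl

end TrendFiltering

/-! ### Basic inequality and non-asymptotic error bound. -/

namespace TrendFiltering

open Finset fwdDiff

section TotalVariation

variable {n : ℕ}

lemma TV_nonneg (r : ℕ) (θ : Fin n → ℝ) : 0 ≤ TV r θ := by unfold TV; positivity

lemma iterDiff_sub (θ θ' : Fin n → ℝ) (r : ℕ) (i : Fin (n - r)) :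
    iterDiff (fun i => θ i - θ' i) r i = iterDiff θ r i - iterDiff θ' r i := by
  rw [iterDiff_eq_fwdDiff, iterDiff_eq_fwdDiff, iterDiff_eq_fwdDiff, ← fwdDiff_iter_fun_sub]
  exact congrArg (fun f => (Δ_[1])^[r] f (i : ℕ)) (map_sub (extendZero n) θ θ')

lemma TV_sub_le (r : ℕ) (θ θ' : Fin n → ℝ) : TV r (fun i => θ i - θ' i) ≤ TV r θ + TV r θ' := by
  unfold TV
  rw [← mul_add, ← sum_add_distrib]
  gcongr with i
  rw [iterDiff_sub]
  exact abs_sub _ _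

lemma abs_iterDiff_le {θ : Fin n → ℝ} (hθ : ∀ i, |θ i| ≤ 1) (r : ℕ) (i : Fin (n - r)) :
    |iterDiff θ r i| ≤ 2 ^ r := by
  induction r with
  | zero => exact (hθ i).trans (by simp)
  | succ r ih =>
    simp only [iterDiff, firstDiff]
    refine (abs_sub _ _).trans ?_
    rw [pow_succ, mul_two]
    exact add_le_add (ih _) (ih _)

end TotalVariation

variable {Ω : Type*} [MeasurableSpace Ω] {μ : Measure Ω} {n : ℕ} {y : Fin n → Ω → ℝ}

lemma maxTV_nonneg (r : ℕ) : 0 ≤ maxTV r μ y := Real.iSup_nonneg fun _ => TV_nonneg r _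

lemma TV_trueCDF_le_maxTV [IsProbabilityMeasure μ] (r : ℕ) (t : ℝ) :
    TV r (trueCDF μ y t) ≤ maxTV r μ y := by
  refine le_ciSup (f := fun t => TV r (trueCDF μ y t))
    ⟨(n : ℝ) ^ (r - 1) * ∑ _i : Fin (n - r), 2 ^ r, ?_⟩ t
  rintro _ ⟨t, rfl⟩
  simp only [TV]
  gcongr with i
  refine abs_iterDiff_le (fun i => ?_) r i
  rw [abs_of_nonneg (trueCDF_nonneg t i)]
  exact trueCDF_le_one t i

section Deterministic

variable {r : ℕ} {η K : ℝ} {w θs θh : Fin n → ℝ}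

/-- The optimality of a minimizer with `λ = η² / (4 TV(θ*))`, tested against `θ*`, as an inequality
between real numbers valid also for `λ = ∞`. -/
lemma exists_real_tuning (hη : η ≠ 0) (hK : 4 * (K * TV r θs) ≤ η ^ 2)
    (hmin : objective r (ENNReal.ofReal (η ^ 2) / (4 * ENNReal.ofReal (TV r θs))) w θh ≤
      objective r (ENNReal.ofReal (η ^ 2) / (4 * ENNReal.ofReal (TV r θs))) w θs) :
    ∃ l : ℝ, K ≤ l ∧ 4 * (l * TV r θs) ≤ η ^ 2 ∧
      (1 / 2) * ∑ i, (w i - θh i) ^ 2 + l * TV r θh ≤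
        (1 / 2) * ∑ i, (w i - θs i) ^ 2 + l * TV r θs := by
  have hη2 : 0 < η ^ 2 := by positivity
  have h0 : ∀ θ : Fin n → ℝ, 0 ≤ (1 / 2) * ∑ i, (w i - θ i) ^ 2 := fun θ => by positivity
  -- If `TV r θs = 0`, the infinite penalty forces `TV r θh = 0`, so any real multiplier works and
  -- `K` itself is taken.
  rcases (TV_nonneg r θs).eq_or_lt with hT | hT
  · simp only [objective, ← hT, ENNReal.ofReal_zero, mul_zero, add_zero] at hmin
    rw [ENNReal.div_zero (by simpa using hη)] at hmin
    have hTh : TV r θh = 0 := by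
      by_contra hne
      have hpos : 0 < TV r θh := lt_of_le_of_ne (TV_nonneg r θh) (Ne.symm hne)
      rw [ENNReal.top_mul (by simpa using hpos), add_top, top_le_iff] at hmin
      exact ENNReal.ofReal_ne_top hmin
    rw [hTh, ENNReal.ofReal_zero, mul_zero, add_zero,
      ENNReal.ofReal_le_ofReal_iff (h0 _)] at hmin
    exact ⟨K, le_rfl, hK, by rw [hTh, ← hT]; linarith⟩
  · have hl : ENNReal.ofReal (η ^ 2) / (4 * ENNReal.ofReal (TV r θs)) =
        ENNReal.ofReal (η ^ 2 / (4 * TV r θs)) := by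
      rw [ENNReal.ofReal_div_of_pos (by positivity), ENNReal.ofReal_mul (by norm_num)]
      norm_num
    have hl0 : 0 ≤ η ^ 2 / (4 * TV r θs) := by positivity
    rw [hl] at hmin
    simp only [objective] at hmin
    rw [← ENNReal.ofReal_mul hl0, ← ENNReal.ofReal_mul hl0,
      ← ENNReal.ofReal_add (h0 _) (mul_nonneg hl0 (TV_nonneg r _)),
      ← ENNReal.ofReal_add (h0 _) (mul_nonneg hl0 (TV_nonneg r _)),
      ENNReal.ofReal_le_ofReal_iff (add_nonneg (h0 _) (mul_nonneg hl0 (TV_nonneg r _)))] at hmin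
    refine ⟨_, ?_, ?_, hmin⟩
    · rw [le_div_iff₀ (by positivity)]; linarith
    · field_simp; exact le_rfl

/-- Basic inequality: a bound on the noise functional at the estimation error bounds the error. -/
lemma sum_sq_error_le (hη : η ≠ 0) (hK0 : 0 ≤ K) (hK : 4 * (K * TV r θs) ≤ η ^ 2)
    (hmin : objective r (ENNReal.ofReal (η ^ 2) / (4 * ENNReal.ofReal (TV r θs))) w θh ≤
      objective r (ENNReal.ofReal (η ^ 2) / (4 * ENNReal.ofReal (TV r θs))) w θs) {Q : ℝ}
    (hQ : ∑ i, (w i - θs i) * (θh i - θs i) ≤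
      Q * √(∑ i, (θh i - θs i) ^ 2) + K * TV r (fun i => θh i - θs i)) :
    ∑ i, (θh i - θs i) ^ 2 ≤ 4 * Q ^ 2 + 2 * η ^ 2 := by
  obtain ⟨l, hKl, hl, hmin'⟩ := exists_real_tuning hη hK hmin
  have hd0 : 0 ≤ ∑ i, (θh i - θs i) ^ 2 := by positivity
  set d := √(∑ i, (θh i - θs i) ^ 2) with hd
  have hdd : d ^ 2 = ∑ i, (θh i - θs i) ^ 2 := Real.sq_sqrt hd0
  have hexpand : ∑ i, (w i - θh i) ^ 2 = ∑ i, (w i - θs i) ^ 2 -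
      2 * ∑ i, (w i - θs i) * (θh i - θs i) + ∑ i, (θh i - θs i) ^ 2 := by
    rw [mul_sum, ← sum_sub_distrib, ← sum_add_distrib]
    exact sum_congr rfl fun i _ => by ring
  have hTV := TV_sub_le r θh θs
  have h1 : K * TV r (fun i => θh i - θs i) ≤ l * (TV r θh + TV r θs) :=
    (mul_le_mul_of_nonneg_right hKl (TV_nonneg r _)).trans
      (mul_le_mul_of_nonneg_left hTV (hK0.trans hKl))
  rw [← hdd] at hexpand ⊢
  -- `Q d ≤ d² / 4 + Q²`, and `l * TV r θs ≤ η² / 4` enters twice, from the objective and from the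
  -- triangle inequality.
  nlinarith [sq_nonneg (d / 2 - Q)]

end Deterministic

lemma abs_noise_le_one [IsProbabilityMeasure μ] (t : ℝ) (i : Fin n) (ω : Ω) :
    |noise μ y t i ω| ≤ 1 := by
  have h0 := trueCDF_nonneg (μ := μ) (y := y) t i
  have h1 := trueCDF_le_one (μ := μ) (y := y) t i
  rw [abs_le]
  by_cases h : y i ω ≤ t <;> simp only [noise, indicatorVec, Set.indicator, Set.mem_Iic, h,
    if_true, if_false] <;> constructor <;> linarith

/-- Cauchy–Schwarz alone, with noise entries bounded by one; it serves when `η²` is at least of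
order `n`. -/
lemma sum_sq_error_le_trivial [IsProbabilityMeasure μ] {r : ℕ} {η : ℝ} (hη : η ≠ 0)
    {Fhat : Ω → ℝ → Fin n → ℝ} (hF : IsPenalizedEstimator r μ y η Fhat) (ω : Ω) (t : ℝ) :
    ∑ i, (Fhat ω t i - trueCDF μ y t i) ^ 2 ≤ 4 * n + 2 * η ^ 2 := by
  have h := sum_sq_error_le (K := 0) (Q := √n) hη le_rfl (by simp; positivity)
    (hF ω t (trueCDF μ y t)) (by
      rw [zero_mul, add_zero]
      refine (Real.sum_mul_le_sqrt_mul_sqrt _ _ _).trans ?_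
      gcongr
      calc _ ≤ ∑ _i : Fin n, (1 : ℝ) := sum_le_sum fun i _ => by
            have := abs_noise_le_one (μ := μ) (y := y) t i ω
            rw [sq_le_one_iff_abs_le_one]
            exact this
        _ = n := by simp)
  rwa [Real.sq_sqrt (Nat.cast_nonneg n)] at h

/-- Non-asymptotic uniform error bound at a given resolution `2 ^ κ`. -/
theorem exists_uniform_error_bound (r : ℕ) : ∃ C : ℝ, 0 ≤ C ∧ ∀ {Ω : Type*} [MeasurableSpace Ω]
    {μ : Measure Ω} [IsProbabilityMeasure μ] {n : ℕ} {y : Fin n → Ω → ℝ} {η : ℝ}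
    {Fhat : Ω → ℝ → Fin n → ℝ} (κ : ℕ), (∀ i, Measurable (y i)) → iIndepFun y μ →
    IsPenalizedEstimator (r + 1) μ y η Fhat → η ≠ 0 → r + 1 ≤ κ → 2 ^ κ ≤ n →
    C * (√2 ^ κ * (2 ^ κ / (n : ℝ)) ^ r) * (4 * maxTV (r + 1) μ y) ≤ η ^ 2 →
    μ {ω | ∃ t, C * ((n : ℝ) / 2 ^ κ + Real.log n + 1) + 2 * η ^ 2 <
      ∑ i, (Fhat ω t i - trueCDF μ y t i) ^ 2} ≤ ENNReal.ofReal (4 / n) := by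
  obtain ⟨C, hC, hdict⟩ := exists_multiscale_functionals r
  -- The summand `C` covers `K`; the powers of `C` come from `8 * C ^ 2 * u₁` and `100` covers the
  -- terms from `u₂`.
  refine ⟨C + 32 * C ^ 3 + 32 * C ^ 2 + 100, by positivity, ?_⟩
  intro Ω _ μ _ n y η Fhat κ hy hindep hF hη hκ hn hcond
  obtain ⟨A, _, X, s, hs, hX, hsum, hmain⟩ := hdict n κ hκ hn
  have hn1 : 1 ≤ n := le_trans Nat.one_le_two_pow hn
  have hnR : (1 : ℝ) ≤ n := by exact_mod_cast hn1
  have hlog : 0 ≤ Real.log n := Real.log_nonneg hnR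
  set m : ℝ := (n : ℝ) / 2 ^ κ with hm
  have hm0 : 0 ≤ m := by positivity
  -- `u₁` and `u₂` make each tail at most `1 / n²`, so `n + 1` cells still leave `O(1 / n)`.
  set u₁ : ℝ := 4 * (C * m) + 4 * Real.log n with hu₁
  set u₂ : ℝ := 2 + 2 * Real.log n with hu₂
  set K : ℝ := C * (√2 ^ κ * (2 ^ κ / (n : ℝ)) ^ r) with hK
  have hK0 : 0 ≤ K := by positivity
  have hKTV : ∀ t, 4 * (K * TV (r + 1) (trueCDF μ y t)) ≤ η ^ 2 := fun t => by
    have h1 := TV_trueCDF_le_maxTV (μ := μ) (y := y) (r + 1) t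
    have hV := maxTV_nonneg (μ := μ) (y := y) (r + 1)
    have h2 : K * (4 * maxTV (r + 1) μ y) ≤
        (C + 32 * C ^ 3 + 32 * C ^ 2 + 100) * (√2 ^ κ * (2 ^ κ / (n : ℝ)) ^ r) *
          (4 * maxTV (r + 1) μ y) := by
      refine mul_le_mul_of_nonneg_right ?_ (by positivity)
      rw [hK]
      refine mul_le_mul_of_nonneg_right ?_ (by positivity)
      nlinarith [pow_nonneg hC 3, pow_nonneg hC 2]
    have h3 := mul_le_mul_of_nonneg_left h1 hK0
    linarith
  refine (measure_mono ?_).trans ((measure_noise_bad_le hy hindep hs hX u₁ u₂).trans ?_)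
  · rintro ω ⟨t, ht⟩
    refine ⟨t, fun t' hS => ?_⟩
    by_contra hcon
    push Not at hcon
    refine absurd ht (not_lt.2 ?_)
    set δ : Fin n → ℝ := fun i => Fhat ω t i - trueCDF μ y t i with hδ
    have hd1 := hmain (fun i => noise μ y t' i ω) δ
    have hd2 := Real.sum_mul_le_sqrt_mul_sqrt univ
      (fun i => noise μ y t i ω - noise μ y t' i ω) δ
    have hq : ∑ i, noise μ y t i ω * δ i ≤
        (C * √u₁ + √(2 * u₂ + 2)) * √(∑ i, δ i ^ 2) + K * TV (r + 1) δ := by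
      have h1 : ∑ i, noise μ y t i ω * δ i = ∑ i, noise μ y t' i ω * δ i +
          ∑ i, (noise μ y t i ω - noise μ y t' i ω) * δ i := by
        rw [← sum_add_distrib]
        exact sum_congr rfl fun i _ => by ring
      have h2 : C * (√2 ^ κ * ((2 ^ κ) ^ r * ∑ i, |iterDiff δ (r + 1) i|)) =
          K * TV (r + 1) δ := by
        simp only [hK, TV, Nat.add_sub_cancel, div_pow]
        field_simp
      rw [h1, ← h2, add_mul]
      have h3 : C * √(∑ a, (max (|X a fun i => noise μ y t' i ω| - s a) 0) ^ 2) *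
          √(∑ i, δ i ^ 2) ≤ C * √u₁ * √(∑ i, δ i ^ 2) := by
        gcongr
      have h4 : √(∑ i, (noise μ y t i ω - noise μ y t' i ω) ^ 2) * √(∑ i, δ i ^ 2) ≤
          √(2 * u₂ + 2) * √(∑ i, δ i ^ 2) := by
        gcongr
      linarith
    have h := sum_sq_error_le hη hK0 (hKTV t) (hF ω t (trueCDF μ y t)) hq
    refine h.trans ?_
    have hu₁0 : 0 ≤ u₁ := by positivity
    have hu₂0 : 0 ≤ 2 * u₂ + 2 := by positivity
    have h5 : (C * √u₁ + √(2 * u₂ + 2)) ^ 2 ≤ 2 * (C ^ 2 * u₁) + 2 * (2 * u₂ + 2) := by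
      have h6 := Real.sq_sqrt hu₁0
      have h7 := Real.sq_sqrt hu₂0
      nlinarith [sq_nonneg (C * √u₁ - √(2 * u₂ + 2))]
    have h8 : 4 * (2 * (C ^ 2 * u₁) + 2 * (2 * u₂ + 2)) ≤
        (C + 32 * C ^ 3 + 32 * C ^ 2 + 100) * (m + Real.log n + 1) := by
      simp only [hu₁, hu₂]
      have a1 : 0 ≤ C ^ 3 := pow_nonneg hC 3
      have a2 : 0 ≤ C ^ 2 := pow_nonneg hC 2
      nlinarith [mul_nonneg a1 hlog, mul_nonneg a2 hm0, mul_nonneg hC hm0, mul_nonneg hC hlog,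
        mul_nonneg a1 hm0, mul_nonneg a2 hlog]
    linarith
  · have hexp : Real.exp (-(2 * Real.log n)) = 1 / (n : ℝ) ^ 2 := by
      rw [Real.exp_neg, show 2 * Real.log n = Real.log n + Real.log n by ring, Real.exp_add,
        Real.exp_log (by positivity), one_div, sq]
    have h1 : Real.exp (2 * ∑ a, Real.exp (-(s a) ^ 2 / 2) - u₁ / 2) ≤ 1 / (n : ℝ) ^ 2 := by
      rw [← hexp]
      apply Real.exp_le_exp.2
      simp only [hu₁]
      linarith
    have h2 : Real.exp (2 - u₂) ≤ 1 / (n : ℝ) ^ 2 := by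
      rw [← hexp]
      apply Real.exp_le_exp.2
      simp only [hu₂]
      linarith
    calc _ ≤ ((n : ℝ≥0∞) + 1) * (ENNReal.ofReal (1 / (n : ℝ) ^ 2) +
          ENNReal.ofReal (1 / (n : ℝ) ^ 2)) := by gcongr
      _ = ENNReal.ofReal ((n + 1) * (1 / (n : ℝ) ^ 2 + 1 / (n : ℝ) ^ 2)) := by
          rw [ENNReal.ofReal_mul (by positivity), ENNReal.ofReal_add (by positivity) zero_le_one,
            ENNReal.ofReal_natCast, ENNReal.ofReal_one,
            ENNReal.ofReal_add (by positivity) (by positivity)]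
      _ ≤ _ := by
          refine ENNReal.ofReal_le_ofReal ?_
          have hn0 : (0 : ℝ) < n := by linarith
          rw [← two_mul, mul_one_div, mul_div_assoc', div_le_div_iff₀ (by positivity) hn0]
          nlinarith

end TrendFiltering

/-! ### Choice of the resolution and conclusion. -/

namespace TrendFiltering

section Scale

variable {r n : ℕ} {V : ℝ}

lemma one_le_log_of_three_le (hn : 3 ≤ n) : 1 ≤ Real.log n := by
  have hn3 : (3 : ℝ) ≤ n := by exact_mod_cast hn
  rw [Real.le_log_iff_exp_le (by linarith)]
  linarith [Real.exp_one_lt_d9]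

lemma log_le_etaScale_sq (hn : 3 ≤ n) : Real.log n ≤ etaScale r n V ^ 2 := by
  have h := one_le_log_of_three_le hn
  calc Real.log n = √(Real.log n) ^ 2 := (Real.sq_sqrt (by linarith)).symm
    _ ≤ _ := by gcongr; exact le_max_right _ _

lemma one_le_etaScale (hn : 3 ≤ n) : 1 ≤ etaScale r n V :=
  (Real.one_le_sqrt.2 (one_le_log_of_three_le hn)).trans (le_max_right _ _)

lemma etaScale_sq_le (hn : 3 ≤ n) (hV : 0 ≤ V) : etaScale r n V ^ 2 ≤ n * rate r n V := by
  have hn0 : (0 : ℝ) < n := by positivity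
  have hlog := one_le_log_of_three_le hn
  set a := (n : ℝ) ^ (1 / (4 * (r : ℝ) + 2)) * V ^ (1 / (2 * (r : ℝ) + 1)) with ha
  have ha0 : 0 ≤ a := by positivity
  have ha2 : a ^ 2 = n * (V ^ (2 / (2 * (r : ℝ) + 1)) /
      (n : ℝ) ^ (2 * (r : ℝ) / (2 * (r : ℝ) + 1))) := by
    have h1 : ((n : ℝ) ^ (1 / (4 * (r : ℝ) + 2))) ^ 2 =
        n / (n : ℝ) ^ (2 * (r : ℝ) / (2 * (r : ℝ) + 1)) := by
      rw [← Real.rpow_natCast, ← Real.rpow_mul hn0.le]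
      conv_rhs => rw [← Real.rpow_one (n : ℝ), ← Real.rpow_mul hn0.le]
      rw [one_mul, ← Real.rpow_sub hn0]
      congr 1
      have : (4 * (r : ℝ) + 2) ≠ 0 := by positivity
      push_cast
      field_simp
      ring
    have h2 : (V ^ (1 / (2 * (r : ℝ) + 1))) ^ 2 = V ^ (2 / (2 * (r : ℝ) + 1)) := by
      rw [← Real.rpow_natCast, ← Real.rpow_mul hV]
      congr 1
      push_cast
      ring
    rw [ha, mul_pow, h1, h2]
    ring
  have hb2 : √(Real.log n) ^ 2 = n * (Real.log n / n) := by
    rw [Real.sq_sqrt (by linarith)]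
    field_simp
  have ht1 : 0 ≤ V ^ (2 / (2 * (r : ℝ) + 1)) / (n : ℝ) ^ (2 * (r : ℝ) / (2 * (r : ℝ) + 1)) := by
    positivity
  have ht2 : 0 ≤ Real.log n / n := by positivity
  rw [rate, mul_add, ← ha2, ← hb2, etaScale, ← ha]
  rcases max_choice a (√(Real.log n)) with h | h <;> rw [h]
  · linarith [sq_nonneg (√(Real.log n))]
  · linarith [sq_nonneg a]

/-- The first term of the maximum, raised to the power `2 * r + 1`, is exactly `√n * V`; this is
what keeps `K` below `λ_t`. -/
lemma sqrt_mul_le_etaScale_pow (hV : 0 ≤ V) : √n * V ≤ etaScale r n V ^ (2 * r + 1) := by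
  have hn0 : (0 : ℝ) ≤ n := Nat.cast_nonneg n
  have hr : (2 * (r : ℝ) + 1) ≠ 0 := by positivity
  have hr' : (4 * (r : ℝ) + 2) ≠ 0 := by positivity
  have h : ((n : ℝ) ^ (1 / (4 * (r : ℝ) + 2)) * V ^ (1 / (2 * (r : ℝ) + 1))) ^ (2 * r + 1) =
      √n * V := by
    rw [mul_pow, ← Real.rpow_natCast, ← Real.rpow_natCast, ← Real.rpow_mul hn0,
      ← Real.rpow_mul hV, Real.sqrt_eq_rpow]
    push_cast
    congr 2
    · field_simp; ring
    · rw [one_div, inv_mul_cancel₀ hr, Real.rpow_one]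
  rw [← h]
  gcongr
  exact le_max_left _ _

end Scale

/-- Choice of the resolution: the truncated level is fine enough for the penalty to dominate. -/
lemma resolution_cond {ρ : ℕ} {C c k H V n b : ℝ} (hC : 0 ≤ C) (hc : 0 < c) (hk : 1 ≤ k)
    (hkC : 4 * C * (1 / c) ^ (2 * ρ + 3) ≤ k) (hH : 0 < H) (hn : 0 < n) (hb : 0 < b) (hV0 : 0 ≤ V)
    (hV : √n * V ≤ (H / c) ^ (2 * ρ + 3)) (hbn : b * (k ^ 2 * H ^ 2) ≤ n) :
    C * (√b * (b / n) ^ ρ) * (4 * V) ≤ H ^ 2 := by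
  have hk0 : 0 < k := by linarith
  have hsn : 0 < √n := Real.sqrt_pos.2 hn
  have h1 : √b * (k * H) ≤ √n := by
    rw [← Real.sqrt_sq (by positivity : 0 ≤ k * H), ← Real.sqrt_mul hb.le]
    exact Real.sqrt_le_sqrt (by rw [mul_pow]; exact hbn)
  have h2 : b / n ≤ 1 / H ^ 2 := by
    rw [div_le_div_iff₀ hn (by positivity), one_mul]
    have : b * H ^ 2 * 1 ≤ b * H ^ 2 * k ^ 2 := by gcongr; nlinarith
    linarith
  have h3 : V ≤ (H / c) ^ (2 * ρ + 3) / √n := by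
    rw [le_div_iff₀ hsn]; linarith
  have h4 : √b ≤ √n / (k * H) := by
    rw [le_div_iff₀ (by positivity)]; exact h1
  -- The exponents of `H` are `-1` from `√b`, `-2ρ` from `(b / n) ^ ρ` and `2ρ + 3` from `V`, which
  -- leaves `H ^ 2`; the factors `√n` cancel.
  calc C * (√b * (b / n) ^ ρ) * (4 * V)
      ≤ C * (√n / (k * H) * (1 / H ^ 2) ^ ρ) * (4 * ((H / c) ^ (2 * ρ + 3) / √n)) := by gcongr
    _ = (4 * C * (1 / c) ^ (2 * ρ + 3)) / k * H ^ 2 := by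
        rw [div_pow, div_pow, div_pow, ← pow_mul, pow_add H, one_pow, one_pow]
        field_simp
    _ ≤ 1 * H ^ 2 := by gcongr; rw [div_le_one hk0]; exact hkC
    _ = H ^ 2 := one_mul _

lemma setOf_lt_worstCaseMSE_subset {Ω : Type*} [MeasurableSpace Ω] {μ : Measure Ω} {n : ℕ}
    {y : Fin n → Ω → ℝ} {Fhat : Ω → ℝ → Fin n → ℝ} {a B : ℝ} (hn : 0 < n) (hB : B ≤ n * a) :
    {ω | ENNReal.ofReal a < worstCaseMSE μ y Fhat ω} ⊆
      {ω | ∃ t, B < ∑ i, (Fhat ω t i - trueCDF μ y t i) ^ 2} := by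
  intro ω hω
  by_contra hcon
  simp only [Set.mem_ofPred_eq, not_exists, not_lt] at hcon
  refine absurd (show ENNReal.ofReal a < worstCaseMSE μ y Fhat ω from hω) (not_lt.2 ?_)
  refine iSup_le fun t => ENNReal.ofReal_le_ofReal ?_
  rw [← Finset.mul_sum, one_div, inv_mul_le_iff₀ (by exact_mod_cast hn)]
  exact (hcon t).trans hB

end TrendFiltering

theorem corollaryB1 (r : ℕ) (hr : 1 ≤ r)
    {Ω : ℕ → Type*} [∀ n, MeasurableSpace (Ω n)]
    (μ : ∀ n, Measure (Ω n)) [∀ n, IsProbabilityMeasure (μ n)]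
    (y : ∀ n, Fin n → Ω n → ℝ)
    (hmeas : ∀ n i, Measurable (y n i))
    (hindep : ∀ n, iIndepFun (y n) (μ n))
    (η : ℕ → ℝ)
    (hη : η =Θ[atTop] fun n => TrendFiltering.etaScale r n (TrendFiltering.maxTV r (μ n) (y n)))
    (Fhat : ∀ n, Ω n → ℝ → Fin n → ℝ)
    (hFhat : ∀ n, TrendFiltering.IsPenalizedEstimator r (μ n) (y n) (η n) (Fhat n)) :
    TrendFiltering.IsBigOInProbability μ
      (fun n => TrendFiltering.worstCaseMSE (μ n) (y n) (Fhat n))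
      (fun n => TrendFiltering.rate r n (TrendFiltering.maxTV r (μ n) (y n))) := by
  open TrendFiltering in
  obtain ⟨ρ, rfl⟩ : ∃ ρ, r = ρ + 1 := ⟨r - 1, by omega⟩
  obtain ⟨C, hC, hbound⟩ := exists_uniform_error_bound ρ
  obtain ⟨c₂, hc₂, hup⟩ := hη.1.exists_pos
  obtain ⟨c₁, hc₁, hlow⟩ := hη.2.exists_pos
  -- The summand `c₁` gives `k * H ≥ 1`, hence `2 ^ κ ≤ n`; the last summand is the requirement of
  -- `resolution_cond` with `c = c₁⁻¹`.
  set k : ℝ := 1 + c₁ + 4 * C * c₁ ^ (2 * ρ + 3) with hk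
  have hk1 : 1 ≤ k := by
    have : 0 ≤ 4 * C * c₁ ^ (2 * ρ + 3) := by positivity
    linarith
  have hkc : c₁ ≤ k := by
    have : 0 ≤ 4 * C * c₁ ^ (2 * ρ + 3) := by positivity
    linarith
  set M : ℝ := C * (2 * (k ^ 2 * c₂ ^ 2) + 2) + 2 * c₂ ^ 2 +
    4 * (2 ^ (ρ + 1) * (k ^ 2 * c₂ ^ 2)) + 1 with hM
  intro ε hε
  refine ⟨M, by positivity, ?_⟩
  have hlim : ∀ᶠ n : ℕ in atTop, 4 / (n : ℝ) ≤ ε :=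
    (tendsto_const_div_atTop_nhds_zero_nat 4).eventually_le_const hε
  filter_upwards [hup.bound, hlow.bound, eventually_ge_atTop 3, hlim] with n hn₂ hn₁ hn3 hnε
  set V := maxTV (ρ + 1) (μ n) (y n) with hV
  have hV0 : 0 ≤ V := maxTV_nonneg (ρ + 1)
  set E := etaScale (ρ + 1) n V with hE
  have hE1 : 1 ≤ E := one_le_etaScale hn3
  rw [Real.norm_eq_abs, Real.norm_eq_abs, abs_of_pos (by linarith : 0 < E)] at hn₁ hn₂
  set H := |η n| with hH
  have hH0 : 0 < H := by
    by_contra hcon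
    have : c₁ * H ≤ 0 := mul_nonpos_of_nonneg_of_nonpos hc₁.le (not_lt.1 hcon)
    linarith
  have hη0 : η n ≠ 0 := abs_pos.1 hH0
  have hHη : η n ^ 2 = H ^ 2 := (sq_abs _).symm
  have hHE : H ^ 2 ≤ c₂ ^ 2 * E ^ 2 := by rw [← mul_pow]; gcongr
  have hErate := etaScale_sq_le (r := ρ + 1) hn3 hV0
  rw [← hE] at hErate
  have hE2 : 1 ≤ E ^ 2 := by nlinarith
  have hlogE : Real.log n ≤ E ^ 2 := log_le_etaScale_sq hn3
  have hn0 : (0 : ℝ) < n := by positivity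
  have hMn : M * E ^ 2 ≤ n * (M * rate (ρ + 1) n V) := by
    have hM0 : 0 ≤ M := by positivity
    nlinarith [mul_le_mul_of_nonneg_left hErate hM0]
  have hkH : 0 < k ^ 2 * H ^ 2 := by positivity
  have hkHE : k ^ 2 * H ^ 2 ≤ k ^ 2 * c₂ ^ 2 * E ^ 2 := by
    rw [mul_assoc]; gcongr
  -- Whether a dyadic block length with `κ ≥ ρ + 1` fits below `n / (k ^ 2 * H ^ 2)`; if none does,
  -- `n` is `O(E ^ 2)`.
  by_cases hcase : 2 ^ (ρ + 1) * (k ^ 2 * H ^ 2) ≤ n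
  · have hx1 : (2 : ℝ) ^ (ρ + 1) ≤ n / (k ^ 2 * H ^ 2) := by
      rw [le_div_iff₀ hkH]; exact hcase
    obtain ⟨κ, hκ1, hκ2⟩ := exists_nat_pow_near
      (le_trans (one_le_pow₀ (by norm_num)) hx1) (by norm_num : (1 : ℝ) < 2)
    rw [le_div_iff₀ hkH] at hκ1
    rw [div_lt_iff₀ hkH] at hκ2
    have hκρ : ρ + 1 ≤ κ := by
      have h1 : (2 : ℝ) ^ (ρ + 1) < 2 ^ (κ + 1) := by
        refine lt_of_mul_lt_mul_right (lt_of_le_of_lt hcase hκ2) hkH.le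
      have := (pow_lt_pow_iff_right₀ (by norm_num : (1 : ℝ) < 2)).1 h1
      omega
    have hkH1 : 1 ≤ k ^ 2 * H ^ 2 := by
      rw [← mul_pow]
      have : 1 ≤ k * H := hE1.trans (hn₁.trans (by gcongr))
      exact one_le_pow₀ this
    have hκn : 2 ^ κ ≤ n := by
      have : (2 : ℝ) ^ κ ≤ n := by
        have := mul_le_mul_of_nonneg_left hkH1 (by positivity : (0 : ℝ) ≤ 2 ^ κ)
        linarith
      exact_mod_cast this
    have hsqrt : √(2 : ℝ) ^ κ = √(2 ^ κ) := by
      rw [Real.sqrt_eq_rpow, Real.sqrt_eq_rpow, ← Real.rpow_natCast, ← Real.rpow_natCast,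
        ← Real.rpow_mul (by norm_num), ← Real.rpow_mul (by norm_num), mul_comm]
    have hVpow : √(n : ℝ) * V ≤ (H / c₁⁻¹) ^ (2 * ρ + 3) := by
      refine (sqrt_mul_le_etaScale_pow (r := ρ + 1) hV0).trans ?_
      rw [div_inv_eq_mul, mul_comm H, show 2 * (ρ + 1) + 1 = 2 * ρ + 3 by ring]
      gcongr
    have hcond := resolution_cond (ρ := ρ) hC (inv_pos.2 hc₁) hk1
      (by rw [one_div, inv_inv]; linarith) hH0 hn0 (by positivity : (0 : ℝ) < 2 ^ κ) hV0 hVpow hκ1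
    rw [← hsqrt, ← hHη] at hcond
    have hfin := hbound κ (hmeas n) (hindep n) (hFhat n) hη0 hκρ hκn hcond
    refine (measure_mono (setOf_lt_worstCaseMSE_subset (by omega) ?_)).trans
      (hfin.trans (ENNReal.ofReal_le_ofReal hnε))
    refine le_trans ?_ hMn
    have hm : (n : ℝ) / 2 ^ κ ≤ 2 * (k ^ 2 * H ^ 2) := by
      rw [div_le_iff₀ (by positivity)]
      rw [pow_succ] at hκ2
      linarith
    have h1 : C * ((n : ℝ) / 2 ^ κ + Real.log n + 1) ≤
        C * (2 * (k ^ 2 * c₂ ^ 2 * E ^ 2) + E ^ 2 + E ^ 2) := by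
      gcongr
      exact hm.trans (by gcongr)
    have h2 : 0 ≤ 4 * (2 ^ (ρ + 1) * (k ^ 2 * c₂ ^ 2)) * E ^ 2 := by positivity
    rw [hHη, hM]
    linarith [sq_nonneg E]
  · have hempty : {ω | ∃ t, 4 * (n : ℝ) + 2 * η n ^ 2 <
        ∑ i, (Fhat n ω t i - trueCDF (μ n) (y n) t i) ^ 2} = ∅ := by
      refine Set.eq_empty_of_forall_notMem fun ω hω => ?_
      obtain ⟨t, ht⟩ := hω
      exact absurd ht (not_lt.2 (sum_sq_error_le_trivial hη0 (hFhat n) ω t))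
    have hle : 4 * (n : ℝ) + 2 * η n ^ 2 ≤ n * (M * rate (ρ + 1) n V) := by
      refine le_trans ?_ hMn
      have h1 : (n : ℝ) ≤ 2 ^ (ρ + 1) * (k ^ 2 * c₂ ^ 2 * E ^ 2) :=
        (not_le.1 hcase).le.trans (by gcongr)
      have h2 : 0 ≤ C * (2 * (k ^ 2 * c₂ ^ 2) + 2) * E ^ 2 := by positivity
      rw [hHη, hM]
      linarith [sq_nonneg E]
    refine (measure_mono (setOf_lt_worstCaseMSE_subset (by omega) hle)).trans ?_
    rw [hempty, measure_empty]
    exact zero_le
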